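/- For a complex Hilbert space $\mathcal H$ let $\mathbb B(\mathcal H)^+$ be the set of positive bounded operators and $\mathbb P(\mathcal H)$ the set of positive invertible ones; $\le$ is the operator order, and $A_k\searrow A$ (resp. $A_k\nearrow A$) means that the sequence $(A_k)$ is decreasing (resp. increasing) and converges to $A$ in the strong operator topology (SOT). A (two-variable, Kubo--Ando) operator mean $\sigma$ is a binary operation on $\mathbb B(\mathcal H)^+$, given for every complex Hilbert space $\mathcal H$, such that (i) $A\le C$, $B\le D$ imply $A\,\sigma\,B\le C\,\sigma\,D$; (ii) $C(A\,\sigma\,B)C\le (CAC)\,\sigma\,(CBC)$ for $C\in\mathbb B(\mathcal H)^+$; (iii) $A_k\searrow A$, $B_k\searrow B$ imply $A_k\,\sigma\,B_k\searrow A\,\sigma\,B$; (iv) $I\,\sigma\,I=I$; and such that there is a function $f_\sigma$ on $(0,\infty)$, the same for all $\mathcal H$, with $I\,\sigma\,(xI)=f_\sigma(x)I$ for $x>0$. The left trivial mean is $A\,\ell\,B=A$. An $n$-variable operator mean on $\mathcal H$ is a map $\mathfrak M:\mathbb P(\mathcal H)^n\to\mathbb P(\mathcal H)$ such that (I) $\mathfrak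 M(A_1,\dots,A_n)\le\mathfrak M(B_1,\dots,B_n)$ whenever $A_j\le B_j$ for all $j$; (II) $S^*\mathfrak M(A_1,\dots,A_n)S=\mathfrak M(S^*A_1S,\dots,S^*A_nS)$ for every invertible $S\in\mathbb B(\mathcal H)$; (III) if $A_{jk}\nearrow A_j$ for all $j$, or $A_{jk}\searrow A_j$ for all $j$, as $k\to\infty$ (all operators in $\mathbb P(\mathcal H)$), then $\mathfrak M(A_{1k},\dots,A_{nk})\to\mathfrak M(A_1,\dots,A_n)$ in SOT; (IV) $\mathfrak M(I,\dots,I)=I$. For an operator mean $\sigma\ne\ell$, the deformed mean $\mathfrak M_\sigma(A_1,\dots,A_n)$ is the unique solution $X\in\mathbb P(\mathcal H)$ of $X=\mathfrak M(X\,\sigma\,A_1,\dots,X\,\sigma\,A_n)$. For a probability vector $\omega$ put $\mathcal A_\omega(A_1,\dots,A_n)=\sum_j\omega_jA_j$ and $\mathcal H_\omega(A_1,\dots,A_n)=\bigl(\sum_j\omega_jA_j^{-1}\bigr)^{-1}$. For $0<m<M$, $p\in\mathbb R\setminus[0,1]$ and $\alpha>0$ put $t_0=\Bigl(\frac{M^p-m^p}{\alpha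 p(M-m)}\Bigr)^{1/(p-1)}$ and $$\gamma(m,M,p,\alpha)=\begin{cases}\alpha(p-1)\Bigl(\frac{M^p-m^p}{\alpha p(M-m)}\Bigr)^{p/(p-1)}+\frac{Mm^p-mM^p}{M-m}&\text{if } m\le t_0\le M,\\ (1-\alpha)M^p&\text{if } M\le t_0,\\ (1-\alpha)m^p&\text{if } t_0\le m,\end{cases}$$ $\gamma(m,M,p)=\gamma(m,M,p,1)$, and let $$K(h,p)=\frac{h^p-h}{(p-1)(h-1)}\left(\frac{p-1}{p}\,\frac{h^p-1}{h^p-h}\right)^p$$ be the generalized Kantorovich constant. **Corollary.** Let $\mathcal H,\mathcal K$ be complex Hilbert spaces, $\omega=(\omega_1,\dots,\omega_n)$ a probability vector, and $\mathfrak M$ an $n$-variable operator mean, given on both $\mathcal H$ and $\mathcal K$ (by maps $\mathbb P(\mathcal H)^n\to\mathbb P(\mathcal H)$ and $\mathbb P(\mathcal K)^n\to\mathbb P(\mathcal K)$, each satisfying (I)--(IV), with no compatibility between the two required), with $\mathcal H_\omega\le\mathfrak M\le\mathcal A_\omega$ on both spaces. Let $\sigma\neq\ell$ be an operator mean, let $0<m<M$,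 $h=M/m$, let $A_1,\dots,A_n\in\mathbb P(\mathcal H)$ with $mI\le A_j\le MI$ for all $j$, let $\Phi:\mathbb B(\mathcal H)\to\mathbb B(\mathcal K)$ be a unital positive linear map, and let $r\in(0,1)$. Then $\mathfrak M_\sigma(A_1,\dots,A_n)$ and $\mathfrak M_\sigma(\Phi(A_1^r),\dots,\Phi(A_n^r))$ are well defined (the defining equations have exactly one positive invertible solution), $$\mathfrak M_\sigma(\Phi(A_1^r),\dots,\Phi(A_n^r))-\Phi(\mathfrak M_\sigma(A_1,\dots,A_n)^r)\le\gamma(1/M,1/m,-r)\,I,$$ and $$\frac{4Mm}{(M+m)^2}K(h,-r)^{-1}\,\Phi(\mathfrak M_\sigma(A_1,\dots,A_n)^r)\le\mathfrak M_\sigma(\Phi(A_1^r),\dots,\Phi(A_n^r))\le K(h,-r)\,\Phi(\mathfrak M_\sigma(A_1,\dots,A_n)^r).$$ -/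

import Mathlib

open Filter Topology

universe u

noncomputable section

/-- `A k ↗ B`: an increasing sequence of operators converging to `B` in the strong operator
topology. -/
def IncreasesTo {H : Type*} [NormedAddCommGroup H] [InnerProductSpace ℂ H] [CompleteSpace H]
    (A : ℕ → H →L[ℂ] H) (B : H →L[ℂ] H) : Prop :=
  Monotone A ∧ ∀ x : H, Tendsto (fun k => A k x) atTop (𝓝 (B x))

/-- `A k ↘ B`: a decreasing sequence of operators converging to `B` in the strong operator
topology. -/
def DecreasesTo {H : Type*} [NormedAddCommGroup H] [InnerProductSpace ℂ H] [CompleteSpace H]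
    (A : ℕ → H →L[ℂ] H) (B : H →L[ℂ] H) : Prop :=
  Antitone A ∧ ∀ x : H, Tendsto (fun k => A k x) atTop (𝓝 (B x))

/-- A two-variable operator mean in the sense of Kubo and Ando: a binary operation on the positive
operators of every complex Hilbert space, satisfying the four axioms on each of them, with one
representing function `f` for all spaces. Only the values of `op` at positive operators matter. -/
structure OperatorMean where
  op : ∀ {H : Type u} [NormedAddCommGroup H] [InnerProductSpace ℂ H] [CompleteSpace H],
    (H →L[ℂ] H) → (H →L[ℂ] H) → (H →L[ℂ] H)
  nonneg : ∀ {H : Type u} [NormedAddCommGroup H] [InnerProductSpace ℂ H] [CompleteSpace H]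
    {A B : H →L[ℂ] H}, 0 ≤ A → 0 ≤ B → 0 ≤ op A B
  monotone : ∀ {H : Type u} [NormedAddCommGroup H] [InnerProductSpace ℂ H] [CompleteSpace H]
    {A B C D : H →L[ℂ] H}, 0 ≤ A → 0 ≤ B → A ≤ C → B ≤ D → op A B ≤ op C D
  transformer : ∀ {H : Type u} [NormedAddCommGroup H] [InnerProductSpace ℂ H] [CompleteSpace H]
    {A B C : H →L[ℂ] H}, 0 ≤ A → 0 ≤ B → 0 ≤ C →
      C * op A B * C ≤ op (C * A * C) (C * B * C)
  downward : ∀ {H : Type u} [NormedAddCommGroup H] [InnerProductSpace ℂ H] [CompleteSpace H]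
    {A B : ℕ → H →L[ℂ] H} {A' B' : H →L[ℂ] H}, (∀ k, 0 ≤ A k) → (∀ k, 0 ≤ B k) →
      DecreasesTo A A' → DecreasesTo B B' → DecreasesTo (fun k => op (A k) (B k)) (op A' B')
  normalized : ∀ {H : Type u} [NormedAddCommGroup H] [InnerProductSpace ℂ H] [CompleteSpace H],
    op (1 : H →L[ℂ] H) 1 = 1
  exists_representing : ∃ f : ℝ → ℝ,
    ∀ {H : Type u} [NormedAddCommGroup H] [InnerProductSpace ℂ H] [CompleteSpace H] (x : ℝ),
      0 < x → op (1 : H →L[ℂ] H) (x • 1) = f x • 1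

/-- `σ` is the left trivial mean `A ℓ B = A`. -/
def OperatorMean.IsLeftTrivial (σ : OperatorMean.{u}) : Prop :=
  ∀ {H : Type u} [NormedAddCommGroup H] [InnerProductSpace ℂ H] [CompleteSpace H]
    (A B : H →L[ℂ] H), 0 ≤ A → 0 ≤ B → σ.op A B = A

/-- An `n`-variable operator mean on the positive invertible operators of `H`. Only the values of
`toFun` at tuples of positive invertible operators matter. -/
structure MultiMean (n : ℕ) (H : Type*) [NormedAddCommGroup H] [InnerProductSpace ℂ H]
    [CompleteSpace H] where
  toFun : (Fin n → H →L[ℂ] H) → (H →L[ℂ] H)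
  strictlyPositive : ∀ A : Fin n → H →L[ℂ] H, (∀ j, IsStrictlyPositive (A j)) →
    IsStrictlyPositive (toFun A)
  monotone : ∀ A B : Fin n → H →L[ℂ] H, (∀ j, IsStrictlyPositive (A j)) →
    (∀ j, IsStrictlyPositive (B j)) → (∀ j, A j ≤ B j) → toFun A ≤ toFun B
  congruence : ∀ (A : Fin n → H →L[ℂ] H) (S : H →L[ℂ] H), (∀ j, IsStrictlyPositive (A j)) →
    IsUnit S → star S * toFun A * S = toFun (fun j => star S * A j * S)
  continuous : ∀ (A : ℕ → Fin n → H →L[ℂ] H) (B : Fin n → H →L[ℂ] H),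
    (∀ k j, IsStrictlyPositive (A k j)) → (∀ j, IsStrictlyPositive (B j)) →
    ((∀ j, IncreasesTo (fun k => A k j) (B j)) ∨ (∀ j, DecreasesTo (fun k => A k j) (B j))) →
    ∀ x : H, Tendsto (fun k => toFun (A k) x) atTop (𝓝 (toFun B x))
  normalized : toFun (fun _ => 1) = 1

section

variable {n : ℕ} {H : Type u} [NormedAddCommGroup H] [InnerProductSpace ℂ H] [CompleteSpace H]

/-- Weighted arithmetic mean. -/
def arithMean (ω : Fin n → ℝ) (A : Fin n → H →L[ℂ] H) : H →L[ℂ] H :=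
  ∑ j, ω j • A j

/-- Weighted harmonic mean. -/
def harmMean (ω : Fin n → ℝ) (A : Fin n → H →L[ℂ] H) : H →L[ℂ] H :=
  Ring.inverse (∑ j, ω j • Ring.inverse (A j))

/-- `ℋ_ω ≤ 𝔐 ≤ 𝒜_ω` on tuples of positive invertible operators. -/
def MultiMean.Between (𝔐 : MultiMean n H) (ω : Fin n → ℝ) : Prop :=
  ∀ A : Fin n → H →L[ℂ] H, (∀ j, IsStrictlyPositive (A j)) →
    harmMean ω A ≤ 𝔐.toFun A ∧ 𝔐.toFun A ≤ arithMean ω A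

/-- `X` is a positive invertible solution of `X = 𝔐(X σ A₁, …, X σ Aₙ)`. -/
def IsDeformedSolution (𝔐 : MultiMean n H) (σ : OperatorMean.{u}) (A : Fin n → H →L[ℂ] H)
    (X : H →L[ℂ] H) : Prop :=
  IsStrictlyPositive X ∧ X = 𝔐.toFun (fun j => σ.op X (A j))

open Classical in
/-- The deformed mean `𝔐_σ(A₁, …, Aₙ)`: the unique positive invertible solution of
`X = 𝔐(X σ A₁, …, X σ Aₙ)` (and `0` if there is no unique solution). -/
def deformedMean (𝔐 : MultiMean n H) (σ : OperatorMean.{u}) (A : Fin n → H →L[ℂ] H) :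
    H →L[ℂ] H :=
  if h : ∃! X, IsDeformedSolution 𝔐 σ A X then h.choose else 0

end

/-- The constant `γ(m, M, r, α)`. -/
def gammaConst (m M r α : ℝ) : ℝ :=
  let t := ((M ^ r - m ^ r) / (α * r * (M - m))) ^ (1 / (r - 1))
  if m ≤ t ∧ t ≤ M then
    α * (r - 1) * ((M ^ r - m ^ r) / (α * r * (M - m))) ^ (r / (r - 1))
      + (M * m ^ r - m * M ^ r) / (M - m)
  else if M ≤ t then (1 - α) * M ^ r
  else (1 - α) * m ^ r

/-- The generalized Kantorovich constant `K(h, p)`. -/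
def kantorovichConst (h p : ℝ) : ℝ :=
  (h ^ p - h) / ((p - 1) * (h - 1)) * ((p - 1) / p * ((h ^ p - 1) / (h ^ p - h))) ^ p

end

/-! Let `f` be the representing function of `σ`. The proof first shows `1 σ B = f(B)`
(`op_one_eq_cfc`), so that `A σ B = A^{1/2} f(A^{-1/2} B A^{-1/2}) A^{1/2}`, and that both `f` and
`x ↦ 1 / f(1/x)` are concave. If `σ` is not left trivial, `f` is strictly increasing, and both
concave functions have support lines at `1` of positive slope. In operator form these give, for some
`s, t > 0`, the bounds `X σ A ≤ (1 - t) X + t A` and `(X σ A)⁻¹ ≤ (1 - s) X⁻¹ + s A⁻¹`.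

Strict monotonicity also makes `X ↦ 𝔐(X σ A₁, …, X σ Aₙ)` a contraction for ratios: from `Y ≤ c X`
the images satisfy the same relation with `c - 1` replaced by `q (c - 1)`, `q < 1`. This yields
existence and uniqueness of the deformed mean. Inserting the two support bounds into the fixed point
equation and cancelling `t` or `s` gives `X ≤ ∑ ωⱼ Aⱼ` and `X⁻¹ ≤ ∑ ωⱼ Aⱼ⁻¹`. The estimates use
nothing else about `𝔐` and `σ`.

The rest is the Mond–Pečarić method. For the upper bounds, `x ^ r = (1/x) ^ (-r)` lies below its
chord, an affine function of `1/x` with negative slope, so `∑ ωⱼ Aⱼ ^ r ≤ β + α X⁻¹`; a tangent line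
then compares the chord with the power, additively (`γ`) or multiplicatively (`K`). For the lower
bound, the chord of the concave power and `X ≤ ∑ ωⱼ Aⱼ` give `K⁻¹ X ^ r ≤ ∑ ωⱼ Aⱼ ^ r`, while the
Kantorovich inequality bounds the mean of the `Φ(Aⱼ ^ r)` below by a multiple of their arithmetic
mean. Only linearity, positivity and unitality of `Φ` enter; no operator Jensen inequality is
needed. -/

set_option linter.unusedSectionVars false

/-! ### Scalar bounds in the operator order. -/

section OperatorOrder

variable {H : Type u} [NormedAddCommGroup H] [InnerProductSpace ℂ H] [CompleteSpace H]

lemma isStrictlyPositive_smul_one {c : ℝ} (hc : 0 < c) :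
    IsStrictlyPositive (c • (1 : H →L[ℂ] H)) :=
  IsStrictlyPositive.smul hc isStrictlyPositive_one

lemma isStrictlyPositive_of_smul_one_le {A : H →L[ℂ] H} {m : ℝ} (hm : 0 < m)
    (h : m • (1 : H →L[ℂ] H) ≤ A) : IsStrictlyPositive A :=
  (isStrictlyPositive_smul_one (H := H) hm).of_le h

lemma spectrum_le_of_le_smul_one {A : H →L[ℂ] H} {M : ℝ} (hA : IsSelfAdjoint A)
    (h : A ≤ M • (1 : H →L[ℂ] H)) : ∀ x ∈ spectrum ℝ A, x ≤ M := by
  rw [← Algebra.algebraMap_eq_smul_one] at h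
  exact (le_algebraMap_iff_spectrum_le hA).1 h

lemma le_spectrum_of_smul_one_le {A : H →L[ℂ] H} {m : ℝ} (hA : IsSelfAdjoint A)
    (h : m • (1 : H →L[ℂ] H) ≤ A) : ∀ x ∈ spectrum ℝ A, m ≤ x := by
  rw [← Algebra.algebraMap_eq_smul_one] at h
  exact (algebraMap_le_iff_le_spectrum hA).1 h

lemma exists_le_smul_one {A : H →L[ℂ] H} (hA : IsSelfAdjoint A) :
    ∃ M : ℝ, 0 < M ∧ A ≤ M • (1 : H →L[ℂ] H) := by
  refine ⟨‖A‖ + 1, by positivity, (hA.le_algebraMap_norm_self).trans ?_⟩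
  rw [Algebra.algebraMap_eq_smul_one]
  exact smul_le_smul_of_nonneg_right (by linarith) zero_le_one

lemma IsStrictlyPositive.exists_smul_one_le {A : H →L[ℂ] H} (hA : IsStrictlyPositive A) :
    ∃ m : ℝ, 0 < m ∧ m • (1 : H →L[ℂ] H) ≤ A := by
  rcases subsingleton_or_nontrivial (H →L[ℂ] H) with _ | _
  · exact ⟨1, one_pos, (Subsingleton.elim _ _).le⟩
  obtain ⟨m, hm, h⟩ := (CFC.exists_pos_algebraMap_le_iff hA.isSelfAdjoint).2
    ((StarOrderedRing.isStrictlyPositive_iff_spectrum_pos A hA.isSelfAdjoint).1 hA)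
  exact ⟨m, hm, by rwa [← Algebra.algebraMap_eq_smul_one]⟩

lemma smul_one_le_smul_one_iff [Nontrivial H] {a b : ℝ} :
    a • (1 : H →L[ℂ] H) ≤ b • (1 : H →L[ℂ] H) ↔ a ≤ b := by
  refine ⟨fun h => ?_, fun h => smul_le_smul_of_nonneg_right h zero_le_one⟩
  have h1 := le_spectrum_of_smul_one_le (m := a) (A := b • (1 : H →L[ℂ] H))
    (IsSelfAdjoint.smul (by simp [isSelfAdjoint_iff]) (.one _)) h b
  apply h1
  rw [← Algebra.algebraMap_eq_smul_one, spectrum.scalar_eq]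
  rfl

lemma le_of_forall_pos_le_add_smul {A B D : H →L[ℂ] H}
    (h : ∀ ε : ℝ, 0 < ε → A ≤ B + ε • D) : A ≤ B := by
  have ht : Tendsto (fun ε : ℝ => B + ε • D) (𝓝[>] 0) (𝓝 (B + (0 : ℝ) • D)) := by
    apply Tendsto.mono_left _ nhdsWithin_le_nhds
    exact (Continuous.tendsto (by fun_prop) 0)
  rw [zero_smul, add_zero] at ht
  exact ge_of_tendsto ht (eventually_nhdsWithin_of_forall h)

end OperatorOrder

/-! ### Homogeneity of an operator mean and elementary properties of its representing function. -/

namespace OperatorMean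

section Basic

variable (σ : OperatorMean.{u})
variable {H : Type u} [NormedAddCommGroup H] [InnerProductSpace ℂ H] [CompleteSpace H]

/-- The reverse inequality is the transformer inequality for `C⁻¹`, conjugated back by `C`. -/
theorem op_conj {A B C : H →L[ℂ] H} (hA : 0 ≤ A) (hB : 0 ≤ B) (hC : IsStrictlyPositive C) :
    C * σ.op A B * C = σ.op (C * A * C) (C * B * C) := by
  refine le_antisymm (σ.transformer hA hB hC.nonneg) ?_
  set D := Ring.inverse C with hD
  have hDC : D * C = 1 := Ring.inverse_mul_cancel _ hC.isUnit
  have hCD : C * D = 1 := Ring.mul_inverse_cancel _ hC.isUnit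
  have hDn : 0 ≤ D := hC.ringInverse.nonneg
  have key (X : H →L[ℂ] H) : D * (C * X * C) * D = X := by
    calc D * (C * X * C) * D = (D * C) * X * (C * D) := by noncomm_ring
      _ = X := by rw [hDC, hCD]; simp
  have key' (X : H →L[ℂ] H) : C * (D * X * D) * C = X := by
    calc C * (D * X * D) * C = (C * D) * X * (D * C) := by noncomm_ring
      _ = X := by rw [hDC, hCD]; simp
  have h := σ.transformer (conjugate_nonneg_of_nonneg hA hC.nonneg)
    (conjugate_nonneg_of_nonneg hB hC.nonneg) hDn
  rw [key, key] at h
  have h2 := conjugate_le_conjugate_of_nonneg h hC.nonneg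
  rwa [key'] at h2

theorem op_smul_smul {A B : H →L[ℂ] H} (hA : 0 ≤ A) (hB : 0 ≤ B) {c : ℝ} (hc : 0 < c) :
    σ.op (c • A) (c • B) = c • σ.op A B := by
  have h := σ.op_conj hA hB (isStrictlyPositive_smul_one (H := H) (Real.sqrt_pos.2 hc))
  simp only [smul_mul_assoc, mul_smul_comm, one_mul, mul_one, smul_smul,
    Real.mul_self_sqrt hc.le] at h
  exact h.symm

/-- The representing function of an operator mean. -/
noncomputable def repr : ℝ → ℝ := σ.exists_representing.choose

theorem op_one_smul {x : ℝ} (hx : 0 < x) :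
    σ.op (1 : H →L[ℂ] H) (x • 1) = σ.repr x • 1 :=
  σ.exists_representing.choose_spec x hx

theorem op_smul_one {x : ℝ} (hx : 0 < x) :
    σ.op (x • (1 : H →L[ℂ] H)) 1 = (x * σ.repr x⁻¹) • 1 := by
  have h := σ.op_smul_smul (H := H) zero_le_one
    (smul_nonneg (inv_pos.2 hx).le (zero_le_one)) hx
  rw [smul_smul, mul_inv_cancel₀ hx.ne', one_smul, σ.op_one_smul (inv_pos.2 hx), smul_smul] at h
  exact h

/-- A two-dimensional Hilbert space in the universe of the mean. -/
abbrev Plane := EuclideanSpace ℂ (ULift.{u} (Fin 2))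

/-- Scalar facts are read off on a space known to be nontrivial, since on the zero space all
multiples of `1` coincide. -/
theorem repr_one : σ.repr 1 = 1 := by
  have h := σ.op_one_smul (H := Plane.{u}) one_pos
  rw [one_smul, σ.normalized] at h
  have h1 : (1 : ℝ) • (1 : Plane.{u} →L[ℂ] Plane.{u}) = σ.repr 1 • 1 := by rw [one_smul, ← h]
  exact le_antisymm (smul_one_le_smul_one_iff.1 h1.ge) (smul_one_le_smul_one_iff.1 h1.le)

theorem repr_mono {x y : ℝ} (hx : 0 < x) (hxy : x ≤ y) : σ.repr x ≤ σ.repr y := by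
  have hy := hx.trans_le hxy
  have h := σ.monotone (H := Plane.{u}) zero_le_one (isStrictlyPositive_smul_one hx).nonneg
    le_rfl (smul_one_le_smul_one_iff.2 hxy)
  rwa [σ.op_one_smul hx, σ.op_one_smul hy, smul_one_le_smul_one_iff] at h

theorem inv_mul_repr_anti {x y : ℝ} (hx : 0 < x) (hxy : x ≤ y) :
    y⁻¹ * σ.repr y ≤ x⁻¹ * σ.repr x := by
  have hy := hx.trans_le hxy
  have h := σ.monotone (H := Plane.{u}) (isStrictlyPositive_smul_one (inv_pos.2 hy)).nonneg
    zero_le_one (smul_one_le_smul_one_iff.2 (inv_anti₀ hx hxy)) le_rfl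
  rwa [σ.op_smul_one (inv_pos.2 hx), σ.op_smul_one (inv_pos.2 hy), smul_one_le_smul_one_iff,
    inv_inv, inv_inv] at h

theorem repr_le_div_mul {x y : ℝ} (hx : 0 < x) (hxy : x ≤ y) :
    σ.repr y ≤ y / x * σ.repr x := by
  have hy := hx.trans_le hxy
  have h := mul_le_mul_of_nonneg_left (σ.inv_mul_repr_anti hx hxy) hy.le
  rw [← mul_assoc, mul_inv_cancel₀ hy.ne', one_mul] at h
  rwa [div_eq_mul_inv, mul_assoc]

theorem repr_pos {x : ℝ} (hx : 0 < x) : 0 < σ.repr x := by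
  rcases le_total x 1 with h | h
  · have := σ.repr_le_div_mul hx h
    rw [σ.repr_one] at this
    by_contra hcon
    have : 1 / x * σ.repr x ≤ 0 := mul_nonpos_of_nonneg_of_nonpos (by positivity) (not_lt.1 hcon)
    linarith
  · have := σ.repr_mono one_pos h
    rw [σ.repr_one] at this
    linarith

/-- Since `f` is increasing and `f(y) / y` is decreasing, `f(y)` is squeezed between `min 1 (y / x)
* f(x)` and `max 1 (y / x) * f(x)`. -/
theorem continuousOn_repr : ContinuousOn σ.repr (Set.Ioi 0) := by
  intro x hx
  have hx : 0 < x := hx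
  refine ContinuousAt.continuousWithinAt ?_
  have h1 : Tendsto (fun y => min 1 (y / x) * σ.repr x) (𝓝 x) (𝓝 (σ.repr x)) := by
    have : ContinuousAt (fun y => min 1 (y / x) * σ.repr x) x := by fun_prop
    simpa [ContinuousAt, hx.ne'] using this
  have h2 : Tendsto (fun y => max 1 (y / x) * σ.repr x) (𝓝 x) (𝓝 (σ.repr x)) := by
    have : ContinuousAt (fun y => max 1 (y / x) * σ.repr x) x := by fun_prop
    simpa [ContinuousAt, hx.ne'] using this
  refine tendsto_of_tendsto_of_tendsto_of_le_of_le' h1 h2 ?_ ?_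
  · filter_upwards [lt_mem_nhds hx] with y hy
    rcases le_total x y with h | h
    · rw [min_eq_left ((one_le_div hx).2 h), one_mul]
      exact σ.repr_mono hx h
    · rw [min_eq_right ((div_le_one hx).2 h)]
      have := mul_le_mul_of_nonneg_left (σ.repr_le_div_mul hy h) (div_pos hy hx).le
      rwa [← mul_assoc, div_mul_div_cancel₀ hx.ne', div_self hy.ne', one_mul] at this
  · filter_upwards [lt_mem_nhds hx] with y hy
    rcases le_total x y with h | h
    · rw [max_eq_right ((one_le_div hx).2 h)]
      exact σ.repr_le_div_mul hx h
    · rw [max_eq_left ((div_le_one hx).2 h), one_mul]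
      exact σ.repr_mono hy h

end Basic

/-! ### Transformer relations for non-invertible operators. -/

section Commuting

variable (σ : OperatorMean.{u})
variable {H : Type u} [NormedAddCommGroup H] [InnerProductSpace ℂ H] [CompleteSpace H]

/-- For `C` commuting with `B`, the transformer inequality for `1 σ B` is an equality. -/
theorem conj_op_one_of_commute {B C : H →L[ℂ] H} (hB : 0 ≤ B) (hC : 0 ≤ C) (h : Commute C B) :
    C * σ.op 1 B * C = σ.op (C * C) (C * B * C) := by
  let δ : ℕ → ℝ := fun k => 1 / ((k : ℝ) + 1)
  have hδ0 (k) : 0 < δ k := Nat.one_div_pos_of_nat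
  have hδa : Antitone δ := fun i j hij => Nat.one_div_le_one_div hij
  have hδt : Tendsto δ atTop (𝓝 0) := tendsto_one_div_add_atTop_nhds_zero_nat
  -- `C` is approximated by invertible `D k`, for which equality is known. When `X` commutes with
  -- `C`, the products `D k * X * D k` decrease, so the downward continuity axiom applies.
  let D : ℕ → H →L[ℂ] H := fun k => C + δ k • 1
  have hDp (k) : IsStrictlyPositive (D k) := by
    have := (isStrictlyPositive_smul_one (H := H) (hδ0 k)).add_nonneg hC
    rwa [add_comm] at this
  have hconj (X : H →L[ℂ] H) (hX : 0 ≤ X) (hXC : Commute C X) :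
      DecreasesTo (fun k => D k * X * D k) (C * X * C) := by
    constructor
    · intro i j hij
      have e (k) : D k * X * D k = C * X * C + (2 * δ k) • (C * X) + (δ k * δ k) • X := by
        simp only [D, add_mul, mul_add, smul_mul_assoc, mul_smul_comm, one_mul, mul_one, smul_add,
          smul_smul, ← hXC.eq, two_mul, add_smul]
        abel
      change D j * X * D j ≤ D i * X * D i
      rw [e, e]
      have h1 := hδa hij
      have hd := hδ0 j
      gcongr
      · exact hXC.mul_nonneg hC hX
    · intro x
      have ht : Tendsto (fun k => D k * X * D k) atTop (𝓝 ((C + (0 : ℝ) • 1) * X * (C + (0 : ℝ) • 1))) := by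
        have : Tendsto D atTop (𝓝 (C + (0 : ℝ) • 1)) := (hδt.smul_const _).const_add _
        exact (this.mul_const _).mul this
      rw [zero_smul, add_zero] at ht
      exact (ContinuousLinearMap.apply ℂ H x).continuous.tendsto _ |>.comp ht
  have h1 := hconj 1 zero_le_one (Commute.one_right _)
  simp only [mul_one] at h1
  have h2 := σ.downward (fun k => ?_) (fun k => ?_) h1 (hconj B hB h)
  rotate_left
  · have := conjugate_nonneg_of_nonneg (zero_le_one (α := H →L[ℂ] H)) (hDp k).nonneg
    rwa [mul_one] at this
  · exact conjugate_nonneg_of_nonneg hB (hDp k).nonneg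
  have e (k) : σ.op (D k * D k) (D k * B * D k) = D k * σ.op 1 B * D k := by
    rw [σ.op_conj zero_le_one hB (hDp k), mul_one]
  ext x
  refine tendsto_nhds_unique ?_ (h2.2 x)
  simp only [e]
  have ht : Tendsto (fun k => D k * σ.op 1 B * D k) atTop
      (𝓝 ((C + (0 : ℝ) • 1) * σ.op 1 B * (C + (0 : ℝ) • 1))) := by
    have : Tendsto D atTop (𝓝 (C + (0 : ℝ) • 1)) := (hδt.smul_const _).const_add _
    exact (this.mul_const _).mul this
  rw [zero_smul, add_zero] at ht
  exact (ContinuousLinearMap.apply ℂ H x).continuous.tendsto _ |>.comp ht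

theorem op_mul_self_smul {C : H →L[ℂ] H} (hC : 0 ≤ C) {x : ℝ} (hx : 0 < x) :
    σ.op (C * C) (x • (C * C)) = σ.repr x • (C * C) := by
  have h := σ.conj_op_one_of_commute (isStrictlyPositive_smul_one hx).nonneg hC
    ((Commute.one_right C).smul_right x)
  rw [σ.op_one_smul hx] at h
  simpa using h.symm

theorem smul_conj_le_op_one {B C : H →L[ℂ] H} {a : ℝ} (hB : 0 ≤ B) (hC : 0 ≤ C) (ha : 0 < a)
    (h : Commute C B) (hab : a • (C * C) ≤ C * B * C) :
    σ.repr a • (C * C) ≤ C * σ.op 1 B * C := by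
  have hCC : 0 ≤ C * C := (Commute.refl C).mul_nonneg hC hC
  rw [σ.conj_op_one_of_commute hB hC h, ← σ.op_mul_self_smul hC ha]
  exact σ.monotone hCC (smul_nonneg ha.le hCC) le_rfl hab

/-- The upper estimate needs only the transformer inequality and hence no commutation, so it can
later be applied to rank-one projections. -/
theorem conj_op_one_le_smul {B C : H →L[ℂ] H} {b : ℝ} (hB : 0 ≤ B) (hC : 0 ≤ C) (hb : 0 < b)
    (hbb : C * B * C ≤ b • (C * C)) : C * σ.op 1 B * C ≤ σ.repr b • (C * C) := by
  have hCC : 0 ≤ C * C := (Commute.refl C).mul_nonneg hC hC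
  refine (σ.transformer zero_le_one hB hC).trans ?_
  rw [mul_one, ← σ.op_mul_self_smul hC hb]
  exact σ.monotone hCC (conjugate_nonneg_of_nonneg hB hC) le_rfl hbb

/-- The left side equals `C² σ (C B C)`, and commutation gives `C² ≤ 1` and `C B C = C² B ≤ B`. -/
theorem conj_op_one_le {B C : H →L[ℂ] H} (hB : 0 ≤ B) (hC : 0 ≤ C) (hC1 : C ≤ 1)
    (h : Commute C B) : C * σ.op 1 B * C ≤ σ.op 1 B := by
  have hCC : 0 ≤ C * C := (Commute.refl C).mul_nonneg hC hC
  have hCC1 : C * C ≤ 1 := by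
    have h1 : 0 ≤ C * (1 - C) :=
      ((Commute.one_right C).sub_right (Commute.refl C)).mul_nonneg hC (sub_nonneg.2 hC1)
    rw [mul_sub, mul_one, sub_nonneg] at h1
    exact h1.trans hC1
  rw [σ.conj_op_one_of_commute hB hC h]
  refine σ.monotone hCC (conjugate_nonneg_of_nonneg hB hC) hCC1 ?_
  have hc : Commute (1 - C * C) B := (Commute.one_left B).sub_left (h.mul_left h)
  have := hc.mul_nonneg (sub_nonneg.2 hCC1) hB
  rw [sub_mul, one_mul, sub_nonneg, mul_assoc, h.eq, ← mul_assoc] at this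
  exact this

/-- `1 σ B` has nonnegative anticommutator with every positive operator commuting with `B`. -/
theorem anticommutator_op_one_nonneg {B G : H →L[ℂ] H} (hB : 0 ≤ B) (hG : 0 ≤ G)
    (h : Commute G B) : 0 ≤ G * σ.op 1 B + σ.op 1 B * G := by
  obtain ⟨M, hM, hGM⟩ := exists_le_smul_one hG.isSelfAdjoint
  set T := σ.op 1 B
  have hT : 0 ≤ T := σ.nonneg zero_le_one hB
  have h1 : 0 ≤ 1 - M⁻¹ • G := by
    rw [sub_nonneg]
    have := smul_le_smul_of_nonneg_left hGM (inv_pos.2 hM).le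
    rwa [smul_smul, inv_mul_cancel₀ hM.ne', one_smul] at this
  have h2 := σ.conj_op_one_le hB h1 (sub_le_self _ (smul_nonneg (inv_pos.2 hM).le hG))
    ((Commute.one_left B).sub_left (h.smul_left _))
  -- With `g = G / M` this is `T - (1 - g) T (1 - g) + g T g = g T + T g`; both summands on the left
  -- are positive.
  have h3 : T - (1 - M⁻¹ • G) * T * (1 - M⁻¹ • G) + (M⁻¹ * M⁻¹) • (G * T * G)
      = M⁻¹ • (G * T + T * G) := by
    simp only [sub_mul, mul_sub, one_mul, mul_one, smul_mul_assoc, mul_smul_comm, smul_smul,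
      smul_add, smul_sub]
    abel
  have h4 : 0 ≤ M⁻¹ • (G * T + T * G) := by
    rw [← h3]
    exact add_nonneg (sub_nonneg.2 h2)
      (smul_nonneg (by positivity) (conjugate_nonneg_of_nonneg hT hG))
  have h5 := smul_nonneg hM.le h4
  rwa [smul_smul, mul_inv_cancel₀ hM.ne', one_smul] at h5

end Commuting

end OperatorMean

/-! ### Identification of `1 σ B` with the functional calculus. -/

namespace OperatorMean

section Representation

variable {H : Type u} [NormedAddCommGroup H] [InnerProductSpace ℂ H] [CompleteSpace H]

/-- If a bounded operator has nonnegative anticommutator with `E* E` for all `E = exp (z B)`,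
then it commutes with the self-adjoint operator `B`, by Liouville's theorem. -/
theorem commute_of_anticommutator_nonneg {T B : H →L[ℂ] H} (hT : IsSelfAdjoint T)
    (hB : IsSelfAdjoint B)
    (h : ∀ G : H →L[ℂ] H, 0 ≤ G → Commute G B → 0 ≤ G * T + T * G) : Commute T B := by
  let E : ℂ → H →L[ℂ] H := fun z => NormedSpace.exp (z • B)
  let F : ℂ → H →L[ℂ] H := fun z => E z * T * E (-z)
  have hEd (z : ℂ) : HasDerivAt E (E z * B) z := hasDerivAt_exp_smul_const B z
  have hEd' (z : ℂ) : HasDerivAt (fun z => E (-z)) (-(E (-z) * B)) z := by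
    have := (hEd (-z)).scomp z (hasDerivAt_neg z)
    rw [neg_one_smul] at this
    exact this
  have hEE (z : ℂ) : E z * E (-z) = 1 := by
    let : NormedAlgebra ℚ (H →L[ℂ] H) := NormedAlgebra.restrictScalars ℚ ℂ _
    have := NormedSpace.exp_add_of_commute (𝔸 := H →L[ℂ] H) (x := z • B) (y := (-z) • B)
      (((Commute.refl B).smul_left z).smul_right (-z))
    rw [← this]
    simp
  have hEB (z : ℂ) : Commute (E z) B := ((Commute.refl B).smul_left z).exp_left
  have hEstar (z : ℂ) : star (E z) = E (star z) := by
    simp only [E, NormedSpace.star_exp, star_smul, hB.star_eq]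
  have hF (z : ℂ) : HasDerivAt F (E z * B * T * E (-z) + E z * T * (-(E (-z) * B))) z :=
    ((hEd z).mul_const T).mul (hEd' z)
  -- Because `E z * E (-z) = 1`, this sum is the congruence by `E (-z)` of `G T + T G`, where `G =
  -- (E z)* E z` is positive and commutes with `B`.
  have hpos (z : ℂ) : 0 ≤ F z + star (F z) := by
    have h1 : star (E (-z)) * star (E z) = 1 := by rw [← star_mul, hEE, star_one]
    have h2 : F z + star (F z) = star (E (-z)) * (star (E z) * E z * T + T * (star (E z) * E z))
        * E (-z) := by
      have : star (F z) = star (E (-z)) * T * star (E z) := by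
        simp only [F, star_mul, hT.star_eq, mul_assoc]
      rw [this]
      calc E z * T * E (-z) + star (E (-z)) * T * star (E z)
          = (star (E (-z)) * star (E z)) * E z * T * E (-z)
            + star (E (-z)) * T * star (E z) * (E z * E (-z)) := by
              rw [h1, hEE]; simp
        _ = _ := by noncomm_ring
    rw [h2]
    refine star_left_conjugate_nonneg (h _ (star_mul_self_nonneg _) ?_) _
    rw [hEstar]
    exact (hEB _).mul_left (hEB z)
  have hconst (v : H) : inner ℂ ((B * T - T * B) v) v = 0 := by
    let φ : ℂ → ℂ := fun z => inner ℂ v (F z v)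
    have hφd (z : ℂ) : HasDerivAt φ
        (inner ℂ v ((E z * B * T * E (-z) + E z * T * (-(E (-z) * B))) v)) z := by
      have h1 : HasDerivAt (fun z => F z v) _ z :=
        ((ContinuousLinearMap.apply ℂ H v).hasFDerivAt.comp_hasDerivAt z (hF z))
      exact (innerSL ℂ v).hasFDerivAt.comp_hasDerivAt z h1
    have hre (z : ℂ) : 0 ≤ (φ z).re := by
      have h1 := ((ContinuousLinearMap.nonneg_iff_isPositive _).1 (hpos z)).re_inner_nonneg_right v
      have h2 : inner ℂ v (star (F z) v) = star (φ z) := by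
        rw [ContinuousLinearMap.star_eq_adjoint, ContinuousLinearMap.adjoint_inner_right,
          ← inner_conj_symm]
        rfl
      rw [add_apply, inner_add_right, h2] at h1
      have h3 : (RCLike.re (φ z + star (φ z)) : ℝ) = 2 * (φ z).re := by
        simp; ring
      change 0 ≤ RCLike.re (φ z + star (φ z)) at h1
      rw [h3] at h1
      linarith
    -- As `φ` has nonnegative real part, `exp (-φ)` is a bounded entire function, hence constant;
    -- its derivative at `0` contains the quadratic form of the commutator.
    have hexp : Differentiable ℂ fun z => Complex.exp (-φ z) :=
      fun z => ((hφd z).differentiableAt.neg).cexp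
    have hb : Bornology.IsBounded (Set.range fun z => Complex.exp (-φ z)) := by
      refine (Metric.isBounded_closedBall (x := (0 : ℂ)) (r := 1)).subset ?_
      rintro _ ⟨z, rfl⟩
      simp only [Metric.mem_closedBall, dist_zero_right, Complex.norm_exp, Complex.neg_re]
      exact Real.exp_le_one_iff.2 (by linarith [hre z])
    have hc : (fun z => Complex.exp (-φ z)) = fun _ => Complex.exp (-φ 0) :=
      funext fun z => hexp.apply_eq_apply_of_bounded hb z 0
    have hd := ((hφd 0).neg).cexp
    have hd0 : HasDerivAt (fun z => Complex.exp (-φ z)) 0 0 := by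
      rw [hc]; exact hasDerivAt_const _ _
    have := hd.unique hd0
    have h0 : inner ℂ v ((B * T - T * B) v) = (0 : ℂ) := by
      have h2 : inner ℂ v (T (B v)) - inner ℂ v (B (T v)) = (0 : ℂ) := by
        simpa [E, Complex.exp_ne_zero, sub_eq_add_neg] using this
      rw [← neg_eq_zero]
      simpa [inner_sub_right] using h2
    rw [← inner_conj_symm, h0, map_zero]
  have h0 := (inner_map_self_eq_zero ((B * T - T * B : H →L[ℂ] H) : H →ₗ[ℂ] H)).1 hconst
  have h1 : B * T - T * B = 0 := ContinuousLinearMap.coe_injective h0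
  exact (sub_eq_zero.1 h1).symm

/-- An operator `W` is positive if its products with functions of `B` supported in short intervals
are. -/
theorem nonneg_of_local_nonneg {W B : H →L[ℂ] H} (hB : IsSelfAdjoint B)
    {δ : ℝ} (hδ : 0 < δ)
    (h : ∀ (a : ℝ) (g : ℝ → ℝ), Continuous g → (∀ x, 0 ≤ g x) →
      (∀ x, x ∉ Set.Icc a (a + δ) → g x = 0) → 0 ≤ cfc g B * W) : 0 ≤ W := by
  have key (n : ℕ) : ∀ (a : ℝ) (g : ℝ → ℝ), Continuous g → (∀ x, 0 ≤ g x) →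
      (∀ x, x ∉ Set.Icc a (a + δ * (3 / 2) ^ n) → g x = 0) → 0 ≤ cfc g B * W := by
    induction n with
    | zero => simpa using h
    | succ n ih =>
      intro a g hg hg0 hsupp
      set l := δ * (3 / 2) ^ n with hl
      have hl0 : 0 < l := by positivity
      have hl' : δ * (3 / 2) ^ (n + 1) = 3 / 2 * l := by rw [hl, pow_succ]; ring
      rw [hl'] at hsupp
      -- A cutoff equal to `1` up to `a + l / 2` and `0` beyond `a + l`. It splits `g` into pieces
      -- carried by two windows of length `l` that overlap in length `l / 2` and cover `3 l / 2`.
      let φ : ℝ → ℝ := fun x => max 0 (min 1 ((a + l - x) / (l / 2)))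
      have hφc : Continuous φ := by fun_prop
      have hφ0 (x) : 0 ≤ φ x := le_max_left _ _
      have hφ1 (x) : φ x ≤ 1 := max_le zero_le_one (min_le_left _ _)
      have e : cfc g B = cfc (fun x => g x * φ x) B + cfc (fun x => g x * (1 - φ x)) B := by
        rw [← cfc_add B _ _ (by fun_prop) (by fun_prop)]
        congr 1
        ext x
        ring
      rw [e, add_mul]
      refine add_nonneg (ih a _ (by fun_prop) (fun x => mul_nonneg (hg0 x) (hφ0 x)) ?_)
        (ih (a + l / 2) _ (by fun_prop)
          (fun x => mul_nonneg (hg0 x) (sub_nonneg.2 (hφ1 x))) ?_)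
      · intro x hx
        by_cases hx' : x ∈ Set.Icc a (a + 3 / 2 * l)
        · have : a + l < x := by
            by_contra hcon
            exact hx ⟨hx'.1, not_lt.1 hcon⟩
          have h2 : φ x = 0 := by
            apply max_eq_left
            refine (min_le_right _ _).trans ?_
            exact div_nonpos_of_nonpos_of_nonneg (by linarith) (by positivity)
          rw [h2, mul_zero]
        · rw [hsupp x hx', zero_mul]
      · intro x hx
        by_cases hx' : x ∈ Set.Icc a (a + 3 / 2 * l)
        · have : x < a + l / 2 := by
            by_contra hcon
            exact hx ⟨not_lt.1 hcon, by linarith [hx'.2]⟩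
          have h1 : 1 ≤ (a + l - x) / (l / 2) := by
            rw [one_le_div (by positivity)]; linarith
          have h2 : φ x = 1 := by
            simp only [φ, min_eq_left h1]
            exact max_eq_right zero_le_one
          rw [h2, sub_self, mul_zero]
        · rw [hsupp x hx', zero_mul]
  obtain ⟨M, hM, hBM⟩ := exists_le_smul_one hB
  obtain ⟨N, hN, hBN⟩ := exists_le_smul_one hB.neg
  have hNB : (-N) • (1 : H →L[ℂ] H) ≤ B := by
    rw [neg_smul]; exact neg_le.1 hBN
  obtain ⟨n, hn⟩ : ∃ n : ℕ, (M + N + 2) / δ < (3 / 2 : ℝ) ^ n :=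
    pow_unbounded_of_one_lt _ (by norm_num)
  rw [div_lt_iff₀ hδ] at hn
  -- `ψ` is `1` on `[-N, M]`, which contains the spectrum of `B`, and vanishes outside `[-N - 1, M +
  -- 1]`.
  let ψ : ℝ → ℝ := fun x => max 0 (min 1 (min (M + 1 - x) (x + N + 1)))
  have hψ := key n (-N - 1) ψ (by fun_prop) (fun x => le_max_left _ _) ?_
  · have e : cfc ψ B = 1 := by
      have : cfc ψ B = cfc (fun _ => (1 : ℝ)) B := by
        apply cfc_congr
        intro x hx
        have h1 := spectrum_le_of_le_smul_one hB hBM x hx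
        have h2 := le_spectrum_of_smul_one_le hB hNB x hx
        have : 1 ≤ min (M + 1 - x) (x + N + 1) := le_min (by linarith) (by linarith)
        simp [ψ, this]
      rw [this, cfc_const_one ℝ B]
    rwa [e, one_mul] at hψ
  · intro x hx
    apply max_eq_left
    refine (min_le_right _ _).trans ?_
    by_contra hcon
    rw [not_le, lt_min_iff] at hcon
    exact hx ⟨by linarith, by linarith⟩

theorem commute_op_one (σ : OperatorMean.{u}) {B : H →L[ℂ] H} (hB : 0 ≤ B) :
    Commute (σ.op 1 B) B :=
  commute_of_anticommutator_nonneg (σ.nonneg zero_le_one hB).isSelfAdjoint hB.isSelfAdjoint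
    fun _ hG h => σ.anticommutator_op_one_nonneg hB hG h

lemma continuousOn_repr_spectrum (σ : OperatorMean.{u}) {B : H →L[ℂ] H}
    (hB : IsStrictlyPositive B) : ContinuousOn σ.repr (spectrum ℝ B) :=
  σ.continuousOn_repr.mono
    ((StarOrderedRing.isStrictlyPositive_iff_spectrum_pos B hB.isSelfAdjoint).1 hB)

lemma cfc_mul_nonneg_of_conj_sqrt {W B : H →L[ℂ] H} {g : ℝ → ℝ} (hg : Continuous g)
    (hg0 : ∀ x, 0 ≤ g x) (hW : Commute W B)
    (h : 0 ≤ cfc (fun x => √(g x)) B * W * cfc (fun x => √(g x)) B) : 0 ≤ cfc g B * W := by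
  have e : cfc g B = cfc (fun x => √(g x)) B * cfc (fun x => √(g x)) B := by
    rw [← cfc_mul _ _ B (by fun_prop) (by fun_prop)]
    congr 1
    ext x
    rw [Real.mul_self_sqrt (hg0 x)]
  rw [mul_assoc, ← (hW.symm.cfc_real fun x => √(g x)).eq, ← mul_assoc, ← e] at h
  exact h

/-- `1 σ B` is the functional calculus of the representing function at `B`. -/
theorem op_one_eq_cfc (σ : OperatorMean.{u}) {B : H →L[ℂ] H} (hB : IsStrictlyPositive B) :
    σ.op 1 B = cfc σ.repr B := by
  have hBsa := hB.isSelfAdjoint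
  set T := σ.op 1 B with hT
  have hTB : Commute T B := σ.commute_op_one hB.nonneg
  have hcont := σ.continuousOn_repr_spectrum hB
  have hSB : Commute (cfc σ.repr B) B := (Commute.refl B).cfc_real _
  obtain ⟨m, hm, hmB⟩ := hB.exists_smul_one_le
  obtain ⟨M, hM, hBM⟩ := exists_le_smul_one hBsa
  have hsm := le_spectrum_of_smul_one_le hBsa hmB
  have hsM := spectrum_le_of_le_smul_one hBsa hBM
  -- The interval is enlarged so that it contains every window of length at most `m / 2` that meets
  -- the spectrum, and still stays away from `0`.
  have hUC : UniformContinuousOn σ.repr (Set.Icc (m / 2) (M + m)) :=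
    isCompact_Icc.uniformContinuousOn_of_continuous
      (σ.continuousOn_repr.mono fun x hx => lt_of_lt_of_le (by positivity) hx.1)
  have key (ε : ℝ) (hε : 0 < ε) :
      0 ≤ ε • 1 - (T - cfc σ.repr B) ∧ 0 ≤ ε • 1 + (T - cfc σ.repr B) := by
    obtain ⟨δ₀, hδ₀, hδ⟩ := Metric.uniformContinuousOn_iff.1 hUC ε hε
    set δ := min (δ₀ / 2) (m / 2) with hδdef
    have hδpos : 0 < δ := lt_min (by positivity) (by positivity)
    have hδ1 : δ < δ₀ := (min_le_left _ _).trans_lt (by linarith)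
    have hδ2 : δ ≤ m / 2 := min_le_right _ _
    have hloc (a : ℝ) (g : ℝ → ℝ) (hg : Continuous g) (hg0 : ∀ x, 0 ≤ g x)
        (hsupp : ∀ x, x ∉ Set.Icc a (a + δ) → g x = 0) :
        let C := cfc (fun x => √(g x)) B
        C * T * C ≤ C * (ε • 1 + cfc σ.repr B) * C ∧ C * (cfc σ.repr B - ε • 1) * C ≤ C * T * C := by
      intro C
      have hC : 0 ≤ C := cfc_nonneg fun x _ => Real.sqrt_nonneg _
      have hgc : ContinuousOn (fun x => √(g x)) (spectrum ℝ B) := by fun_prop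
      have hCB : Commute C B := (Commute.refl B).cfc_real _
      have hconj (k : ℝ → ℝ) (hk : ContinuousOn k (spectrum ℝ B)) :
          C * cfc k B * C = cfc (fun x => √(g x) * k x * √(g x)) B := by
        rw [cfc_mul _ _ B (by fun_prop) (by fun_prop), cfc_mul _ _ B (by fun_prop) (by fun_prop)]
      have hCC (c : ℝ) : c • (C * C) = cfc (fun x => √(g x) * c * √(g x)) B := by
        have := hconj (fun _ => c) (by fun_prop)
        rw [← this, cfc_const c B, Algebra.algebraMap_eq_smul_one]
        simp
      have hCBC : C * B * C = cfc (fun x => √(g x) * x * √(g x)) B := by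
        have := hconj (fun x => x) (by fun_prop)
        rwa [cfc_id' ℝ B] at this
      have e1 : ε • 1 + cfc σ.repr B = cfc (fun x => ε + σ.repr x) B := by
        rw [cfc_const_add ε _ B hcont, Algebra.algebraMap_eq_smul_one]
      have e2 : cfc σ.repr B - ε • 1 = cfc (fun x => σ.repr x - ε) B := by
        rw [cfc_sub _ _ B hcont (by fun_prop), cfc_const ε B, Algebra.algebraMap_eq_smul_one]
      rw [e1, e2, hconj _ (by fun_prop), hconj _ (by fun_prop)]
      -- If the window meets the spectrum, `C T C` is squeezed between `f(a) C²` and `f(a + δ) C²`,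
      -- and `f` varies by less than `ε` there; otherwise `C = 0`.
      by_cases hne : ∃ x ∈ spectrum ℝ B, g x ≠ 0
      · obtain ⟨x₀, hx₀, hgx₀⟩ := hne
        have hx₀' : x₀ ∈ Set.Icc a (a + δ) := by
          by_contra hcon; exact hgx₀ (hsupp _ hcon)
        have ham : m / 2 ≤ a := by linarith [hsm x₀ hx₀, hx₀'.2]
        have haM : a + δ ≤ M + m := by linarith [hsM x₀ hx₀, hx₀'.1]
        have ha0 : 0 < a := by linarith
        have hclose (x y : ℝ) (hx : x ∈ Set.Icc a (a + δ)) (hy : y ∈ Set.Icc a (a + δ)) :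
            σ.repr x < σ.repr y + ε := by
          have := hδ x ⟨ham.trans hx.1, hx.2.trans haM⟩ y ⟨ham.trans hy.1, hy.2.trans haM⟩ (by
            rw [Real.dist_eq, abs_lt]; constructor <;> linarith [hx.1, hx.2, hy.1, hy.2])
          rw [Real.dist_eq, abs_lt] at this
          linarith [this.2]
        have hmem {x : ℝ} (hx : x ∉ Set.Icc a (a + δ)) : √(g x) = 0 := by
          rw [hsupp x hx, Real.sqrt_zero]
        constructor
        · refine (σ.conj_op_one_le_smul hB.nonneg hC (b := a + δ) (by positivity) ?_).trans ?_
          · rw [hCBC, hCC]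
            refine cfc_mono (fun x _ => ?_)
            by_cases hx : x ∈ Set.Icc a (a + δ)
            · have := hx.2
              gcongr
            · simp [hmem hx]
          · rw [hCC]
            refine cfc_mono (fun x _ => ?_)
            by_cases hx : x ∈ Set.Icc a (a + δ)
            · have := hclose (a + δ) x ⟨by linarith, le_rfl⟩ hx
              gcongr
              linarith
            · simp [hmem hx]
        · refine le_trans ?_ (σ.smul_conj_le_op_one hB.nonneg hC ha0 hCB ?_)
          · rw [hCC]
            refine cfc_mono (fun x _ => ?_)
            by_cases hx : x ∈ Set.Icc a (a + δ)
            · have := hclose x a hx ⟨le_rfl, by linarith⟩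
              gcongr
              linarith
            · simp [hmem hx]
          · rw [hCBC, hCC]
            refine cfc_mono (fun x _ => ?_)
            by_cases hx : x ∈ Set.Icc a (a + δ)
            · have := hx.1
              gcongr
            · simp [hmem hx]
      · push Not at hne
        have hC0 : C = 0 := by
          have : C = cfc (fun _ => (0 : ℝ)) B := cfc_congr fun x hx => by simp [hne x hx]
          rw [this, cfc_const_zero]
        rw [← hconj _ (by fun_prop), ← hconj _ (by fun_prop), hC0]
        simp
    have hWc : Commute (T - cfc σ.repr B) B := hTB.sub_left hSB
    have h1c : Commute (ε • (1 : H →L[ℂ] H)) B := (Commute.one_left B).smul_left _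
    constructor
    · refine nonneg_of_local_nonneg hBsa hδpos fun a g hg hg0 hsupp => ?_
      refine cfc_mul_nonneg_of_conj_sqrt hg hg0 (h1c.sub_left hWc) ?_
      have := sub_nonneg.2 (hloc a g hg hg0 hsupp).1
      convert this using 1
      noncomm_ring
    · refine nonneg_of_local_nonneg hBsa hδpos fun a g hg hg0 hsupp => ?_
      refine cfc_mul_nonneg_of_conj_sqrt hg hg0 (h1c.add_left hWc) ?_
      have := sub_nonneg.2 (hloc a g hg hg0 hsupp).2
      convert this using 1
      noncomm_ring
  refine le_antisymm (le_of_forall_pos_le_add_smul (D := 1) fun ε hε => ?_)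
    (le_of_forall_pos_le_add_smul (D := 1) fun ε hε => ?_)
  · rw [← sub_nonneg]
    convert (key ε hε).1 using 1
    abel
  · rw [← sub_nonneg]
    convert (key ε hε).2 using 1
    abel

end Representation

end OperatorMean

/-! ### Rank-one estimates for the mean. -/

namespace OperatorMean

section RankOne

variable (σ : OperatorMean.{u})
variable {H : Type u} [NormedAddCommGroup H] [InnerProductSpace ℂ H] [CompleteSpace H]

open InnerProductSpace (rankOne)

lemma rankOne_mul_mul_rankOne (v : H) (T : H →L[ℂ] H) :
    rankOne ℂ v v * T * rankOne ℂ v v = inner ℂ v (T v) • rankOne ℂ v v := by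
  ext x
  simp [InnerProductSpace.rankOne_apply, smul_smul, mul_comm]

lemma rankOne_mul_self {v : H} (hv : ‖v‖ = 1) :
    rankOne ℂ v v * rankOne ℂ v v = rankOne ℂ v v := by
  have := rankOne_mul_mul_rankOne v (1 : H →L[ℂ] H)
  rw [mul_one] at this
  rw [this, one_apply_eq_self, inner_self_eq_norm_sq_to_K, hv]
  simp

lemma rankOne_nonneg (v : H) : 0 ≤ rankOne ℂ v v :=
  (ContinuousLinearMap.nonneg_iff_isPositive _).2 (InnerProductSpace.isPositive_rankOne_self v)

lemma inner_apply_eq_re {T : H →L[ℂ] H} (hT : IsSelfAdjoint T) (v : H) :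
    inner ℂ v (T v) = ((inner ℂ v (T v)).re : ℂ) := by
  have h := hT.isSymmetric v v
  have : inner ℂ (T v) v = inner ℂ v (T v) := h
  refine (Complex.conj_eq_iff_re.1 ?_).symm
  rw [inner_conj_symm, this]

lemma re_inner_apply_mono {S T : H →L[ℂ] H} (h : S ≤ T) (v : H) :
    (inner ℂ v (S v)).re ≤ (inner ℂ v (T v)).re := by
  have := ((ContinuousLinearMap.le_def _ _).1 h).re_inner_nonneg_right v
  rw [sub_apply, inner_sub_right] at this
  simpa using this

lemma re_inner_rankOne (v w : H) :
    (inner ℂ w (rankOne ℂ v v w)).re = ‖inner ℂ v w‖ ^ 2 := by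
  rw [InnerProductSpace.rankOne_apply, inner_smul_right, ← inner_conj_symm w v,
    RCLike.mul_conj]
  norm_cast

lemma re_inner_pos {T : H →L[ℂ] H} (hT : IsStrictlyPositive T) {v : H} (hv : ‖v‖ = 1) :
    0 < (inner ℂ v (T v)).re := by
  obtain ⟨m, hm, h⟩ := hT.exists_smul_one_le
  refine hm.trans_le ?_
  have := re_inner_apply_mono h v
  simpa [inner_smul_right_eq_smul, inner_self_eq_norm_sq_to_K, hv] using this

lemma real_smul_eq_complex_smul (c : ℝ) (T : H →L[ℂ] H) : (c : ℂ) • T = c • T := by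
  ext; simp

/-- Jensen's inequality for the mean in a unit vector. -/
theorem re_inner_op_one_le {B : H →L[ℂ] H} (hB : IsStrictlyPositive B) {v : H} (hv : ‖v‖ = 1) :
    (inner ℂ v (σ.op 1 B v)).re ≤ σ.repr (inner ℂ v (B v)).re := by
  have hpos := re_inner_pos hB hv
  have hP := rankOne_nonneg v
  have h := σ.conj_op_one_le_smul hB.nonneg hP hpos (by
    rw [rankOne_mul_mul_rankOne, rankOne_mul_self hv, inner_apply_eq_re hB.isSelfAdjoint,
      real_smul_eq_complex_smul]
    simp)
  rw [rankOne_mul_mul_rankOne, rankOne_mul_self hv,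
    inner_apply_eq_re (σ.nonneg zero_le_one hB.nonneg).isSelfAdjoint,
    real_smul_eq_complex_smul] at h
  have h2 := re_inner_apply_mono h v
  simpa [InnerProductSpace.rankOne_apply, inner_smul_right_eq_smul, inner_self_eq_norm_sq_to_K, hv]
    using h2

/-- Cauchy–Schwarz for `√D v` and `√D (E x)`, since `x = D (E x)`. -/
lemma norm_inner_sq_le {D E : H →L[ℂ] H} (hD : 0 ≤ D) (hDE : D * E = 1) (v x : H) :
    ‖inner ℂ v x‖ ^ 2 ≤ (inner ℂ v (D v)).re * (inner ℂ x (E x)).re := by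
  set S := CFC.sqrt D
  have hS : S * S = D := CFC.sqrt_mul_sqrt_self D hD
  have hSsa : IsSelfAdjoint S := (CFC.sqrt_nonneg D).isSelfAdjoint
  have hsym (a b : H) : inner ℂ (S a) b = inner ℂ a (S b) := hSsa.isSymmetric a b
  have e (y : H) : S (S y) = D y := by rw [← hS]; rfl
  have hx : D (E x) = x := by
    have := congrArg (fun T : H →L[ℂ] H => T x) hDE
    exact this
  have h1 : inner ℂ v x = inner ℂ (S v) (S (E x)) := by rw [hsym, e, hx]
  have h2 : (inner ℂ v (D v)).re = ‖S v‖ ^ 2 := by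
    rw [← e, ← hsym]; exact inner_self_eq_norm_sq (𝕜 := ℂ) _
  have h3 : (inner ℂ x (E x)).re = ‖S (E x)‖ ^ 2 := by
    nth_rewrite 1 [← hx]
    rw [← e, hsym]; exact inner_self_eq_norm_sq (𝕜 := ℂ) _
  rw [h1, h2, h3, ← mul_pow]
  exact pow_le_pow_left₀ (norm_nonneg _) (norm_inner_le_norm _ _) 2

lemma le_of_re_inner_le {S T : H →L[ℂ] H} (hS : IsSelfAdjoint S) (hT : IsSelfAdjoint T)
    (h : ∀ v, (inner ℂ v (S v)).re ≤ (inner ℂ v (T v)).re) : S ≤ T := by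
  rw [ContinuousLinearMap.le_def, ContinuousLinearMap.isPositive_def']
  refine ⟨hT.sub hS, fun v => ?_⟩
  rw [ContinuousLinearMap.reApplyInnerSelf_apply, ← inner_re_symm, sub_apply, inner_sub_right]
  simpa using h v

lemma rankOne_le_one {v : H} (hv : ‖v‖ = 1) : rankOne ℂ v v ≤ (1 : H →L[ℂ] H) := by
  refine le_of_re_inner_le (rankOne_nonneg v).isSelfAdjoint (.one _) fun w => ?_
  rw [re_inner_rankOne, one_apply_eq_self]
  have h1 := norm_inner_le_norm (𝕜 := ℂ) v w
  have h2 : (inner ℂ w w).re = ‖w‖ ^ 2 := inner_self_eq_norm_sq (𝕜 := ℂ) w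
  rw [hv, one_mul] at h1
  rw [h2]
  exact pow_le_pow_left₀ (norm_nonneg _) h1 2

/-- A rank-one lower bound for the mean. -/
theorem smul_rankOne_le_op_one {D E : H →L[ℂ] H} (hD : IsStrictlyPositive D)
    (hE : IsStrictlyPositive E) (hDE : D * E = 1) {v : H} (hv : ‖v‖ = 1) :
    σ.repr ((inner ℂ v (D v)).re)⁻¹ • rankOne ℂ v v ≤ σ.op 1 E := by
  set c := (inner ℂ v (D v)).re with hc
  have hpos : 0 < c := re_inner_pos hD hv
  have hP := rankOne_nonneg v
  have h := σ.op_mul_self_smul hP (inv_pos.2 hpos)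
  rw [rankOne_mul_self hv] at h
  rw [← h]
  have hcP : 0 ≤ c⁻¹ • rankOne ℂ v v := smul_nonneg (inv_pos.2 hpos).le hP
  refine σ.monotone hP hcP (rankOne_le_one hv) ?_
  refine le_of_re_inner_le hcP.isSelfAdjoint hE.isSelfAdjoint fun w => ?_
  have h1 := norm_inner_sq_le hD.nonneg hDE v w
  have h2 : (inner ℂ w ((c⁻¹ • rankOne ℂ v v : H →L[ℂ] H) w)).re = c⁻¹ * ‖inner ℂ v w‖ ^ 2 := by
    rw [← re_inner_rankOne]
    simp [inner_smul_right_eq_smul]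
  rw [h2, inv_mul_le_iff₀ hpos]
  exact h1

lemma apply_eq_zero_of_re_inner_nonpos {X : H →L[ℂ] H} (hX : 0 ≤ X) {v : H}
    (h : (inner ℂ v (X v)).re ≤ 0) : X v = 0 := by
  set S := CFC.sqrt X
  have hS : S * S = X := CFC.sqrt_mul_sqrt_self X hX
  have hSsa : IsSelfAdjoint S := (CFC.sqrt_nonneg X).isSelfAdjoint
  have hsym (a b : H) : inner ℂ (S a) b = inner ℂ a (S b) := hSsa.isSymmetric a b
  have e (y : H) : X y = S (S y) := by rw [← hS]; rfl
  rw [e, ← hsym] at h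
  have h1 : (inner ℂ (S v) (S v)).re = ‖S v‖ ^ 2 := inner_self_eq_norm_sq (𝕜 := ℂ) _
  rw [h1] at h
  have h2 : S v = 0 := by
    rw [← norm_eq_zero]; nlinarith [norm_nonneg (S v)]
  rw [e, h2, map_zero]

/-- The mean `1 σ E` acts on an eigenvector of `E` through the representing function. -/
theorem op_one_apply_eigenvector {D E : H →L[ℂ] H} (hD : IsStrictlyPositive D)
    (hE : IsStrictlyPositive E) (hDE : D * E = 1) {v : H} (hv : ‖v‖ = 1) {d : ℝ} (hd : 0 < d)
    (hEv : E v = d • v) : σ.op 1 E v = σ.repr d • v := by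
  have hDv : D v = d⁻¹ • v := by
    have h1 : D (E v) = v := congrArg (fun T : H →L[ℂ] H => T v) hDE
    rw [hEv, ContinuousLinearMap.map_smul_of_tower] at h1
    rw [← h1, smul_smul, inv_mul_cancel₀ hd.ne', one_smul, h1]
  have h1 := σ.re_inner_op_one_le hE hv
  have h2 := σ.smul_rankOne_le_op_one hD hE hDE hv
  have e1 : (inner ℂ v (E v)).re = d := by simp [hEv, inner_smul_right_eq_smul, hv]
  have e2 : (inner ℂ v (D v)).re⁻¹ = d := by simp [hDv, inner_smul_right_eq_smul, hv]
  rw [e1] at h1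
  rw [e2] at h2
  -- At an eigenvector the rank-one lower bound and Jensen's upper bound agree, so the positive
  -- difference has zero quadratic form at `v` and annihilates `v`.
  have h3 := apply_eq_zero_of_re_inner_nonpos (sub_nonneg.2 h2) (v := v) (by
    simpa [inner_sub_right, InnerProductSpace.rankOne_apply, inner_smul_right_eq_smul, hv] using h1)
  simpa [InnerProductSpace.rankOne_apply, hv, sub_eq_zero] using h3

end RankOne

/-! ### Concavity of `f` and of `x ↦ 1 / f(1/x)` from diagonal operators on the plane. -/

section Concave

open InnerProductSpace (rankOne)

variable {H : Type u} [NormedAddCommGroup H] [InnerProductSpace ℂ H] [CompleteSpace H]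

/-- The operator equal to `a` on the line of `e` and to `b` on its orthogonal complement. -/
noncomputable def twoValued (e : H) (a b : ℝ) : H →L[ℂ] H :=
  a • rankOne ℂ e e + b • (1 - rankOne ℂ e e)

lemma twoValued_isStrictlyPositive {e : H} (he : ‖e‖ = 1) {a b : ℝ} (ha : 0 < a) (hb : 0 < b) :
    IsStrictlyPositive (twoValued e a b) := by
  refine isStrictlyPositive_of_smul_one_le (lt_min ha hb) ?_
  have : (min a b) • (1 : H →L[ℂ] H)
      = min a b • rankOne ℂ e e + min a b • (1 - rankOne ℂ e e) := by
    rw [← smul_add]; simp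
  rw [this, twoValued]
  exact add_le_add (smul_le_smul_of_nonneg_right (min_le_left _ _) (rankOne_nonneg e))
    (smul_le_smul_of_nonneg_right (min_le_right _ _) (sub_nonneg.2 (rankOne_le_one he)))

lemma twoValued_mul_inv {e : H} (he : ‖e‖ = 1) {a b : ℝ} (ha : 0 < a) (hb : 0 < b) :
    twoValued e a b * twoValued e a⁻¹ b⁻¹ = 1 := by
  have hP := rankOne_mul_self (v := e) he
  set P := rankOne ℂ e e
  have h1 : P * (1 - P) = 0 := by rw [mul_sub, mul_one, hP, sub_self]
  have h2 : (1 - P) * P = 0 := by rw [sub_mul, one_mul, hP, sub_self]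
  have h3 : (1 - P) * (1 - P) = 1 - P := by rw [mul_sub, mul_one, h2, sub_zero]
  change (a • P + b • (1 - P)) * (a⁻¹ • P + b⁻¹ • (1 - P)) = 1
  rw [add_mul, mul_add, mul_add]
  simp only [smul_mul_assoc, mul_smul_comm, smul_smul, h1, h2, h3, hP, smul_zero, add_zero,
    zero_add]
  rw [inv_mul_cancel₀ ha.ne', inv_mul_cancel₀ hb.ne', one_smul, one_smul]
  abel

lemma twoValued_apply_self {e : H} (he : ‖e‖ = 1) (a b : ℝ) : twoValued e a b e = a • e := by
  simp [twoValued, InnerProductSpace.rankOne_apply, inner_self_eq_norm_sq_to_K, he]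

lemma twoValued_apply_orthogonal {e w : H} (h : inner ℂ e w = (0 : ℂ)) (a b : ℝ) :
    twoValued e a b w = b • w := by
  simp [twoValued, InnerProductSpace.rankOne_apply, h]

lemma inner_combination {e w : H} (he : ‖e‖ = 1) (hw : ‖w‖ = 1) (h : inner ℂ e w = (0 : ℂ))
    (p q s t : ℝ) :
    inner ℂ (p • e + q • w) (s • e + t • w) = ((p * s + q * t : ℝ) : ℂ) := by
  have h' : inner ℂ w e = (0 : ℂ) := by rw [← inner_conj_symm, h, map_zero]
  simp [inner_add_left, inner_smul_left_eq_smul, inner_smul_right_eq_smul, h, h',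
    inner_self_eq_norm_sq_to_K, he, hw]
  ring

lemma norm_sqrt_combination {e w : H} (he : ‖e‖ = 1) (hw : ‖w‖ = 1) (h : inner ℂ e w = (0 : ℂ))
    {p q : ℝ} (hp : 0 ≤ p) (hq : 0 ≤ q) (hpq : p + q = 1) : ‖√p • e + √q • w‖ = 1 := by
  have h1 := congrArg Complex.re (inner_combination he hw h (√p) (√q) (√p) (√q))
  rw [Real.mul_self_sqrt hp, Real.mul_self_sqrt hq, hpq] at h1
  have h2 := inner_self_eq_norm_sq (𝕜 := ℂ) (√p • e + √q • w)
  have h3 : ‖√p • e + √q • w‖ ^ 2 = 1 := by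
    rw [← h2]; exact h1
  nlinarith [norm_nonneg (√p • e + √q • w)]

lemma exists_orthonormal_pair : ∃ e w : Plane.{u}, ‖e‖ = 1 ∧ ‖w‖ = 1 ∧ inner ℂ e w = (0 : ℂ) :=
  ⟨EuclideanSpace.single ⟨0⟩ 1, EuclideanSpace.single ⟨1⟩ 1, by simp, by simp, by simp [EuclideanSpace.inner_single_left]⟩

variable (σ : OperatorMean.{u})

theorem concaveOn_repr : ConcaveOn ℝ (Set.Ioi 0) σ.repr := by
  refine ⟨convex_Ioi 0, ?_⟩
  intro a ha b hb p q hp hq hpq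
  have ha : 0 < a := ha
  have hb : 0 < b := hb
  obtain ⟨e, w, he, hw, hew⟩ := exists_orthonormal_pair.{u}
  have hE := twoValued_isStrictlyPositive he ha hb
  have hD := twoValued_isStrictlyPositive he (inv_pos.2 ha) (inv_pos.2 hb)
  have hDE : twoValued e a⁻¹ b⁻¹ * twoValued e a b = 1 := by
    simpa using twoValued_mul_inv he (inv_pos.2 ha) (inv_pos.2 hb)
  have h1 := σ.op_one_apply_eigenvector hD hE hDE he ha (twoValued_apply_self he a b)
  have h2 := σ.op_one_apply_eigenvector hD hE hDE hw hb (twoValued_apply_orthogonal hew a b)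
  set v : Plane.{u} := √p • e + √q • w with hvdef
  have hv : ‖v‖ = 1 := norm_sqrt_combination he hw hew hp hq hpq
  have hval (S : Plane.{u} →L[ℂ] Plane.{u}) (s t : ℝ) (hs : S e = s • e) (ht : S w = t • w) :
      (inner ℂ v (S v)).re = p * s + q * t := by
    have : S v = (√p * s) • e + (√q * t) • w := by
      rw [hvdef, map_add, ContinuousLinearMap.map_smul_of_tower, ContinuousLinearMap.map_smul_of_tower, hs, ht, smul_smul, smul_smul]
    rw [this, inner_combination he hw hew, Complex.ofReal_re, ← mul_assoc, ← mul_assoc,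
      Real.mul_self_sqrt hp, Real.mul_self_sqrt hq]
  have h3 := σ.re_inner_op_one_le hE hv
  rw [hval _ _ _ h1 h2, hval _ _ _ (twoValued_apply_self he a b)
    (twoValued_apply_orthogonal hew a b)] at h3
  simpa using h3

theorem concaveOn_inv_repr_inv : ConcaveOn ℝ (Set.Ioi 0) fun x => (σ.repr x⁻¹)⁻¹ := by
  refine ⟨convex_Ioi 0, ?_⟩
  intro a ha b hb p q hp hq hpq
  have ha : 0 < a := ha
  have hb : 0 < b := hb
  obtain ⟨e, w, he, hw, hew⟩ := exists_orthonormal_pair.{u}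
  have hD := twoValued_isStrictlyPositive he ha hb
  have hE := twoValued_isStrictlyPositive he (inv_pos.2 ha) (inv_pos.2 hb)
  have hDE : twoValued e a b * twoValued e a⁻¹ b⁻¹ = 1 := twoValued_mul_inv he ha hb
  have h1 := σ.op_one_apply_eigenvector hD hE hDE he (inv_pos.2 ha) (twoValued_apply_self he _ _)
  have h2 := σ.op_one_apply_eigenvector hD hE hDE hw (inv_pos.2 hb)
    (twoValued_apply_orthogonal hew _ _)
  have hfa := σ.repr_pos (inv_pos.2 ha)
  have hfb := σ.repr_pos (inv_pos.2 hb)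
  set fa := σ.repr a⁻¹
  set fb := σ.repr b⁻¹
  set v : Plane.{u} := √p • e + √q • w with hvdef
  -- The test vector is `x = T⁻¹ v` with `T = 1 σ E`. Then `⟨v, x⟩` and `⟨x, T x⟩` are both `s = p /
  -- fa + q / fb`, and the rank-one bound reads `f(1 / (p a + q b)) s² ≤ s`.
  set x : Plane.{u} := (√p * fa⁻¹) • e + (√q * fb⁻¹) • w with hxdef
  have hv : ‖v‖ = 1 := norm_sqrt_combination he hw hew hp hq hpq
  have hvD : (inner ℂ v (twoValued e a b v)).re = p * a + q * b := by
    have : twoValued e a b v = (√p * a) • e + (√q * b) • w := by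
      rw [hvdef, map_add, ContinuousLinearMap.map_smul_of_tower, ContinuousLinearMap.map_smul_of_tower, twoValued_apply_self he,
        twoValued_apply_orthogonal hew, smul_smul, smul_smul]
    rw [this, inner_combination he hw hew, Complex.ofReal_re, ← mul_assoc, ← mul_assoc,
      Real.mul_self_sqrt hp, Real.mul_self_sqrt hq]
  have hxT : (inner ℂ x (σ.op 1 (twoValued e a⁻¹ b⁻¹) x)).re = p * fa⁻¹ + q * fb⁻¹ := by
    have : σ.op 1 (twoValued e a⁻¹ b⁻¹) x = √p • e + √q • w := by
      rw [hxdef, map_add, ContinuousLinearMap.map_smul_of_tower, ContinuousLinearMap.map_smul_of_tower, h1, h2, smul_smul, smul_smul,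
        mul_assoc, mul_assoc, inv_mul_cancel₀ hfa.ne', inv_mul_cancel₀ hfb.ne', mul_one, mul_one]
    rw [this, inner_combination he hw hew, Complex.ofReal_re, mul_right_comm,
      Real.mul_self_sqrt hp, mul_right_comm, Real.mul_self_sqrt hq]
  have hvx : inner ℂ v x = ((p * fa⁻¹ + q * fb⁻¹ : ℝ) : ℂ) := by
    rw [inner_combination he hw hew, ← mul_assoc, ← mul_assoc,
      Real.mul_self_sqrt hp, Real.mul_self_sqrt hq]
  have h3 := re_inner_apply_mono (σ.smul_rankOne_le_op_one hD hE hDE hv) x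
  have h4 : (inner ℂ x ((σ.repr (inner ℂ v (twoValued e a b v)).re⁻¹ • rankOne ℂ v v :
      Plane.{u} →L[ℂ] Plane.{u}) x)).re = σ.repr (p * a + q * b)⁻¹ * ‖inner ℂ v x‖ ^ 2 := by
    rw [hvD, ← re_inner_rankOne]
    simp [inner_smul_right_eq_smul]
  rw [h4, hxT, hvx, Complex.norm_real, Real.norm_eq_abs, sq_abs] at h3
  have hs : 0 < p * fa⁻¹ + q * fb⁻¹ := by
    rcases hp.eq_or_lt with rfl | hp
    · have : q = 1 := by linarith
      subst this; simp [hfb]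
    · have := mul_pos hp (inv_pos.2 hfa)
      have := mul_nonneg hq (inv_pos.2 hfb).le
      linarith
  have hc : 0 < p * a + q * b := (convex_Ioi (0 : ℝ)) ha hb hp hq hpq
  have hfc := σ.repr_pos (inv_pos.2 hc)
  simp only [smul_eq_mul]
  change p * fa⁻¹ + q * fb⁻¹ ≤ (σ.repr (p * a + q * b)⁻¹)⁻¹
  refine le_of_mul_le_mul_right ?_ hfc
  rw [inv_mul_cancel₀ hfc.ne']
  refine le_of_mul_le_mul_left ?_ hs
  linarith

end Concave

end OperatorMean

/-- The slope is the supremum of the chord slopes to the right of `1`. Concavity bounds it by every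
chord slope to the left, and the chord to `y` makes it positive. -/
lemma ConcaveOn.exists_pos_support_at_one {g : ℝ → ℝ} (hg : ConcaveOn ℝ (Set.Ioi 0) g)
    (h1 : g 1 = 1) {y : ℝ} (hy : 1 < y) (hgy : 1 < g y) :
    ∃ t : ℝ, 0 < t ∧ ∀ x, 0 < x → g x ≤ 1 - t + t * x := by
  let S : Set ℝ := (fun z => (g z - 1) / (z - 1)) '' Set.Ioi 1
  have hle (x : ℝ) (hx0 : 0 < x) (hx1 : x < 1) : ∀ s ∈ S, s ≤ (1 - g x) / (1 - x) := by
    rintro _ ⟨z, hz, rfl⟩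
    have hz : 1 < z := hz
    have := hg.slope_anti_adjacent (x := x) (y := 1) (z := z) hx0 (zero_lt_one.trans hz) hx1 hz
    rwa [h1] at this
  have hbdd : BddAbove S := ⟨_, fun s hs => hle (1 / 2) (by norm_num) (by norm_num) s hs⟩
  have hmem (z : ℝ) (hz : 1 < z) : (g z - 1) / (z - 1) ≤ sSup S :=
    le_csSup hbdd ⟨z, hz, rfl⟩
  refine ⟨sSup S, (div_pos (by linarith) (by linarith)).trans_le (hmem y hy), fun x hx => ?_⟩
  rcases lt_trichotomy x 1 with hx1 | rfl | hx1
  · have : sSup S ≤ (1 - g x) / (1 - x) := csSup_le ⟨_, y, hy, rfl⟩ (hle x hx hx1)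
    rw [le_div_iff₀ (by linarith)] at this
    linarith
  · linarith
  · have := hmem x hx1
    rw [div_le_iff₀ (by linarith)] at this
    linarith

section AffineCalculus

variable {H : Type u} [NormedAddCommGroup H] [InnerProductSpace ℂ H] [CompleteSpace H]

lemma IsStrictlyPositive.spectrum_real_pos {Z : H →L[ℂ] H} (hZ : IsStrictlyPositive Z) :
    ∀ x ∈ spectrum ℝ Z, 0 < x :=
  (StarOrderedRing.isStrictlyPositive_iff_spectrum_pos (R := ℝ) Z hZ.isSelfAdjoint).1 hZ

lemma IsStrictlyPositive.continuousOn_inv {Z : H →L[ℂ] H} (hZ : IsStrictlyPositive Z) :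
    ContinuousOn (fun x : ℝ => x⁻¹) (spectrum ℝ Z) :=
  continuousOn_inv₀.mono fun x hx => (hZ.spectrum_real_pos x hx).ne'

lemma cfc_affine (α β : ℝ) {Z : H →L[ℂ] H} (hZ : IsSelfAdjoint Z) :
    cfc (fun x => β + α * x) Z = β • 1 + α • Z := by
  rw [cfc_const_add β (fun x => α * x) Z (by fun_prop) hZ, cfc_const_mul_id α Z hZ,
    Algebra.algebraMap_eq_smul_one]

lemma cfc_affine_inv (α β : ℝ) {Z : H →L[ℂ] H} (hZ : IsStrictlyPositive Z) :
    cfc (fun x => β + α * x⁻¹) Z = β • 1 + α • Ring.inverse Z := by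
  have h1 := hZ.continuousOn_inv
  have h2 : ContinuousOn (fun x : ℝ => α * x⁻¹) (spectrum ℝ Z) := h1.const_smul α
  have h3 : cfc (fun x : ℝ => x⁻¹) Z = Ring.inverse Z := by
    rw [cfc_inv (fun x => x) Z (fun x hx => (hZ.spectrum_real_pos x hx).ne') continuousOn_id
      hZ.isSelfAdjoint, cfc_id' ℝ Z hZ.isSelfAdjoint]
  rw [cfc_const_add β (fun x => α * x⁻¹) Z h2 hZ.isSelfAdjoint,
    cfc_const_mul α (fun x => x⁻¹) Z h1, h3, Algebra.algebraMap_eq_smul_one]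

end AffineCalculus

/-! ### The Kubo–Ando formula. -/

namespace OperatorMean

variable (σ : OperatorMean.{u})
variable {H : Type u} [NormedAddCommGroup H] [InnerProductSpace ℂ H] [CompleteSpace H]

open CFC

section Formula

/-- Congruence by `A^{1/2}` normalises the first argument to `1`. -/
theorem op_eq_conjSqrt {A B : H →L[ℂ] H} (hA : IsStrictlyPositive A) (hB : IsStrictlyPositive B) :
    σ.op A B = conjSqrt A (cfc σ.repr (conjSqrt (Ring.inverse A) B)) := by
  have hZ : IsStrictlyPositive (conjSqrt (Ring.inverse A) B) :=
    (isStrictlyPositive_conjSqrt_iff _ _ hA.ringInverse).2 hB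
  rw [← σ.op_one_eq_cfc hZ, conjSqrt_apply, σ.op_conj zero_le_one hZ.nonneg hA.sqrt,
    ← conjSqrt_apply, ← conjSqrt_apply, conjSqrt_one A hA.nonneg,
    conjSqrt_conjSqrt_ringInverse A B hA]

lemma isStrictlyPositive_cfc_repr {B : H →L[ℂ] H} (hB : IsStrictlyPositive B) :
    IsStrictlyPositive (cfc σ.repr B) := by
  rw [cfc_isStrictlyPositive_iff σ.repr B (σ.continuousOn_repr_spectrum hB) hB.isSelfAdjoint]
  exact fun x hx => σ.repr_pos
    (hB.spectrum_real_pos x hx)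

theorem op_isStrictlyPositive {A B : H →L[ℂ] H} (hA : IsStrictlyPositive A)
    (hB : IsStrictlyPositive B) : IsStrictlyPositive (σ.op A B) := by
  rw [σ.op_eq_conjSqrt hA hB, isStrictlyPositive_conjSqrt_iff _ _ hA]
  exact σ.isStrictlyPositive_cfc_repr ((isStrictlyPositive_conjSqrt_iff _ _ hA.ringInverse).2 hB)

theorem exists_repr_ne_one (hσ : ¬ σ.IsLeftTrivial) : ∃ x, 0 < x ∧ σ.repr x ≠ 1 := by
  by_contra! h
  refine hσ fun {H} _ _ _ A B hA hB => ?_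
  have hstrict {A B : H →L[ℂ] H} (hA : IsStrictlyPositive A) (hB : IsStrictlyPositive B) :
      σ.op A B = A := by
    rw [σ.op_eq_conjSqrt hA hB]
    have hZ : IsStrictlyPositive (conjSqrt (Ring.inverse A) B) :=
      (isStrictlyPositive_conjSqrt_iff _ _ hA.ringInverse).2 hB
    have : cfc σ.repr (conjSqrt (Ring.inverse A) B) = 1 := by
      rw [cfc_congr (g := fun _ => (1 : ℝ)), cfc_const_one ℝ _ hZ.isSelfAdjoint]
      exact fun x hx => h x
        (hZ.spectrum_real_pos x hx)
    rw [this, conjSqrt_one A hA.nonneg]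
  -- Left triviality concerns all positive operators; the shifts by `δ k` carry it over from the
  -- invertible ones by downward continuity.
  let δ : ℕ → ℝ := fun k => 1 / ((k : ℝ) + 1)
  have hδ0 (k) : 0 < δ k := Nat.one_div_pos_of_nat
  have hδa : Antitone δ := fun i j hij => Nat.one_div_le_one_div hij
  have hδt : Tendsto δ atTop (𝓝 0) := tendsto_one_div_add_atTop_nhds_zero_nat
  have hdec (X : H →L[ℂ] H) : DecreasesTo (fun k => X + δ k • 1) X := by
    refine ⟨fun i j hij => add_le_add le_rfl
      (smul_le_smul_of_nonneg_right (hδa hij) zero_le_one), fun x => ?_⟩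
    have : Tendsto (fun k => X x + δ k • x) atTop (𝓝 (X x + (0 : ℝ) • x)) :=
      (hδt.smul_const x).const_add _
    simpa using this
  have hpos {X : H →L[ℂ] H} (hX : 0 ≤ X) (k) : IsStrictlyPositive (X + δ k • 1) :=
    (isStrictlyPositive_smul_one (hδ0 k)).nonneg_add hX
  have h1 := σ.downward (fun k => (hpos hA k).nonneg) (fun k => (hpos hB k).nonneg)
    (hdec A) (hdec B)
  simp only [hstrict (hpos hA _) (hpos hB _)] at h1
  ext x
  exact tendsto_nhds_unique (h1.2 x) ((hdec A).2 x)

end Formula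

/-! ### Consequences of `σ ≠ ℓ`: support bounds and ratio contraction. -/

section Strict

/-- If `f(p) = f(q)`, concavity of `f` makes it constant to the right of `p`, and concavity of `x ↦
1 / f(1/x)` makes it constant to the left. Then `f` is identically `1` and the mean is left trivial.
-/
theorem repr_strictMono (hσ : ¬ σ.IsLeftTrivial)
    {p q : ℝ} (hp : 0 < p) (hpq : p < q) : σ.repr p < σ.repr q := by
  refine lt_of_le_of_ne (σ.repr_mono hp hpq.le) fun heq => ?_
  have hq := hp.trans hpq
  have hbig (y : ℝ) (hy : p ≤ y) : σ.repr y = σ.repr p := by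
    refine le_antisymm ?_ (σ.repr_mono hp hy)
    rcases le_or_gt y q with hyq | hyq
    · exact (σ.repr_mono (hp.trans_le hy) hyq).trans heq.ge
    · have := σ.concaveOn_repr.slope_anti_adjacent (x := p) (y := q) (z := y) hp (hq.trans hyq) hpq
        hyq
      rw [← heq, sub_self, zero_div, div_le_iff₀ (by linarith), zero_mul] at this
      linarith
  have hall (y : ℝ) (hy : 0 < y) : σ.repr y = σ.repr p := by
    rcases le_or_gt p y with hpy | hpy
    · exact hbig y hpy
    · refine le_antisymm (σ.repr_mono hy hpy.le) ?_
      have := σ.concaveOn_inv_repr_inv.slope_anti_adjacent (x := q⁻¹) (y := p⁻¹) (z := y⁻¹)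
        (inv_pos.2 hq) (inv_pos.2 hy) (inv_strictAnti₀ hp hpq) (inv_strictAnti₀ hy hpy)
      simp only [inv_inv] at this
      rw [← heq, sub_self, zero_div, div_le_iff₀ (sub_pos.2 (inv_strictAnti₀ hy hpy)), zero_mul,
        sub_nonpos, inv_le_inv₀ (σ.repr_pos hy) (σ.repr_pos hp)] at this
      exact this
  obtain ⟨x, hx, hne⟩ := σ.exists_repr_ne_one hσ
  apply hne
  rw [hall x hx, ← hall 1 one_pos, σ.repr_one]

theorem exists_repr_le_affine (hσ : ¬ σ.IsLeftTrivial)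
    : ∃ t : ℝ, 0 < t ∧ ∀ x, 0 < x → σ.repr x ≤ 1 - t + t * x := by
  refine σ.concaveOn_repr.exists_pos_support_at_one σ.repr_one (y := 2) (by norm_num) ?_
  have := σ.repr_strictMono hσ (p := 1) (q := 2) one_pos (by norm_num)
  rwa [σ.repr_one] at this

theorem exists_inv_repr_le_affine (hσ : ¬ σ.IsLeftTrivial) :
    ∃ t : ℝ, 0 < t ∧ ∀ x, 0 < x → (σ.repr x)⁻¹ ≤ 1 - t + t * x⁻¹ := by
  obtain ⟨t, ht, h⟩ := σ.concaveOn_inv_repr_inv.exists_pos_support_at_one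
    (by simp [σ.repr_one]) (y := 2) (by norm_num) (by
      have := σ.repr_strictMono hσ (p := 2⁻¹) (q := 1) (by norm_num) (by norm_num)
      rw [σ.repr_one] at this
      exact (one_lt_inv₀ (σ.repr_pos (by norm_num))).2 this)
  exact ⟨t, ht, fun x hx => by simpa using h x⁻¹ (inv_pos.2 hx)⟩

/-- An operator mean other than the left trivial one is dominated by a weighted arithmetic mean. -/
theorem exists_op_le (hσ : ¬ σ.IsLeftTrivial) : ∃ t : ℝ, 0 < t ∧
    ∀ {H : Type u} [NormedAddCommGroup H] [InnerProductSpace ℂ H] [CompleteSpace H]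
      {A B : H →L[ℂ] H}, IsStrictlyPositive A → IsStrictlyPositive B →
      σ.op A B ≤ (1 - t) • A + t • B := by
  obtain ⟨t, ht, h⟩ := σ.exists_repr_le_affine hσ
  refine ⟨t, ht, fun {H} _ _ _ {A B} hA hB => ?_⟩
  have hZ : IsStrictlyPositive (conjSqrt (Ring.inverse A) B) :=
    (isStrictlyPositive_conjSqrt_iff _ _ hA.ringInverse).2 hB
  have hpos := hZ.spectrum_real_pos
  have hle : cfc σ.repr (conjSqrt (Ring.inverse A) B)
      ≤ (1 - t) • 1 + t • conjSqrt (Ring.inverse A) B := by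
    rw [← cfc_affine t (1 - t) hZ.isSelfAdjoint]
    exact cfc_mono (fun x hx => h x (hpos x hx)) (σ.continuousOn_repr_spectrum hZ)
  rw [σ.op_eq_conjSqrt hA hB]
  refine (conjSqrt_le_conjSqrt hle).trans_eq ?_
  rw [map_add, map_smul, map_smul, conjSqrt_one A hA.nonneg, conjSqrt_conjSqrt_ringInverse A B hA]

/-- An operator mean other than the left trivial one dominates a weighted harmonic mean. -/
theorem exists_inverse_op_le (hσ : ¬ σ.IsLeftTrivial) : ∃ t : ℝ, 0 < t ∧
    ∀ {H : Type u} [NormedAddCommGroup H] [InnerProductSpace ℂ H] [CompleteSpace H]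
      {A B : H →L[ℂ] H}, IsStrictlyPositive A → IsStrictlyPositive B →
      Ring.inverse (σ.op A B) ≤ (1 - t) • Ring.inverse A + t • Ring.inverse B := by
  obtain ⟨t, ht, h⟩ := σ.exists_inv_repr_le_affine hσ
  refine ⟨t, ht, fun {H} _ _ _ {A B} hA hB => ?_⟩
  have hZ : IsStrictlyPositive (conjSqrt (Ring.inverse A) B) :=
    (isStrictlyPositive_conjSqrt_iff _ _ hA.ringInverse).2 hB
  have hcont := σ.continuousOn_repr_spectrum hZ
  have hZi : Ring.inverse (conjSqrt (Ring.inverse A) B) = conjSqrt A (Ring.inverse B) := by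
    rw [ringInverse_conjSqrt _ _ hA.ringInverse, Ring.inverse_inverse hA.isUnit]
  set Z := conjSqrt (Ring.inverse A) B with hZdef
  have hpos := hZ.spectrum_real_pos
  have hinvc := hZ.continuousOn_inv
  have hne : ∀ x ∈ spectrum ℝ Z, σ.repr x ≠ 0 := fun x hx => (σ.repr_pos (hpos x hx)).ne'
  have hle : Ring.inverse (cfc σ.repr Z) ≤ (1 - t) • 1 + t • Ring.inverse Z := by
    rw [← cfc_affine_inv t (1 - t) hZ, ← cfc_inv σ.repr Z hne hcont hZ.isSelfAdjoint]
    exact cfc_mono (fun x hx => h x (hpos x hx)) (hcont.inv₀ hne)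
      (continuousOn_const.add (hinvc.const_smul t))
  rw [σ.op_eq_conjSqrt hA hB, ringInverse_conjSqrt _ _ hA]
  refine (conjSqrt_le_conjSqrt hle).trans_eq ?_
  rw [map_add, map_smul, map_smul, conjSqrt_one _ hA.ringInverse.nonneg, hZi,
    conjSqrt_ringInverse_conjSqrt A _ hA]

/-- The map `X ↦ X σ A` contracts multiplicative perturbations of `X`, at a rate that depends only
on the bounds of `A` relative to `X`. -/
theorem exists_op_smul_le (hσ : ¬ σ.IsLeftTrivial) {z₀ z₁ : ℝ} (hz₀ : 0 < z₀) (hz : z₀ ≤ z₁) :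
    ∃ η : ℝ, 0 < η ∧ η ≤ 1 ∧
    ∀ {H : Type u} [NormedAddCommGroup H] [InnerProductSpace ℂ H] [CompleteSpace H]
      {X A : H →L[ℂ] H}, IsStrictlyPositive X → IsStrictlyPositive A → z₀ • X ≤ A → A ≤ z₁ • X →
      ∀ c : ℝ, 1 ≤ c → σ.op (c • X) A ≤ (1 + (1 - η) * (c - 1)) • σ.op X A := by
  have hz₁ := hz₀.trans_le hz
  have hκ := σ.repr_strictMono hσ hz₁ (lt_add_one z₁)
  set κ := σ.repr (z₁ + 1) - σ.repr z₁ with hκdef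
  have hκ0 : 0 < κ := sub_pos.2 hκ
  have hf₁ := σ.repr_pos hz₁
  -- By concavity, chords of `f` left of `z₁` have slope at least `κ`, so `c f(z/c) ≤ c f(z) - κ (c
  -- - 1) z`. This `η` ensures `η f(z) ≤ κ z` on `[z₀, z₁]`.
  refine ⟨min 1 (κ * z₀ / σ.repr z₁), lt_min one_pos (by positivity), min_le_left _ _,
    fun {H} _ _ _ {X A} hX hA h0 h1 c hc => ?_⟩
  set η := min 1 (κ * z₀ / σ.repr z₁)
  have hη : η * σ.repr z₁ ≤ κ * z₀ := by
    rw [← le_div_iff₀ hf₁]; exact min_le_right _ _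
  have hη0 : 0 < η := lt_min one_pos (by positivity)
  have hc0 : 0 < c := by linarith
  have hscal (z : ℝ) (hz0 : z₀ ≤ z) (hz1 : z ≤ z₁) :
      c * σ.repr (c⁻¹ * z) ≤ (1 + (1 - η) * (c - 1)) * σ.repr z := by
    have hzpos : 0 < z := hz₀.trans_le hz0
    rcases hc.eq_or_lt with rfl | hc1
    · simp
    have hlt : c⁻¹ * z < z := by
      rw [inv_mul_lt_iff₀ hc0]; nlinarith
    have hcz : 0 < c⁻¹ * z := by positivity
    have hslope : κ ≤ (σ.repr z - σ.repr (c⁻¹ * z)) / (z - c⁻¹ * z) := by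
      have hz₂ : (0 : ℝ) < z₁ + 1 := by linarith
      have hκ1 : κ = (σ.repr (z₁ + 1) - σ.repr z₁) / (z₁ + 1 - z₁) := by simp [hκdef]
      rcases hz1.eq_or_lt with rfl | hz1
      · rw [hκ1]
        exact σ.concaveOn_repr.slope_anti_adjacent hcz hz₂ hlt (lt_add_one _)
      · rw [hκ1]
        exact (σ.concaveOn_repr.slope_anti_adjacent hzpos hz₂ hz1 (lt_add_one _)).trans
          (σ.concaveOn_repr.slope_anti_adjacent hcz hz₁ hlt hz1)
    rw [le_div_iff₀ (by linarith)] at hslope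
    have h3 : σ.repr z ≤ σ.repr z₁ := σ.repr_mono hzpos hz1
    have h4 : c * (c⁻¹ * z) = z := by field_simp
    have h5 : c * σ.repr (c⁻¹ * z) ≤ c * σ.repr z - κ * (c - 1) * z := by
      have := mul_le_mul_of_nonneg_left hslope hc0.le
      nlinarith
    have h6 : η * σ.repr z ≤ κ * z := by nlinarith
    nlinarith
  have hXi := hX.ringInverse
  set Z := conjSqrt (Ring.inverse X) A with hZdef
  have hZ : IsStrictlyPositive Z := (isStrictlyPositive_conjSqrt_iff _ _ hXi).2 hA
  have hZ0 : z₀ • (1 : H →L[ℂ] H) ≤ Z := by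
    have := conjSqrt_le_conjSqrt (c := Ring.inverse X) h0
    rwa [map_smul, conjSqrt_ringInverse_self X hX] at this
  have hZ1 : Z ≤ z₁ • (1 : H →L[ℂ] H) := by
    have := conjSqrt_le_conjSqrt (c := Ring.inverse X) h1
    rwa [map_smul, conjSqrt_ringInverse_self X hX] at this
  have hs0 := le_spectrum_of_smul_one_le hZ.isSelfAdjoint hZ0
  have hs1 := spectrum_le_of_le_smul_one hZ.isSelfAdjoint hZ1
  have hcZ : IsStrictlyPositive (c⁻¹ • Z) := hZ.smul (inv_pos.2 hc0)
  have hcont := σ.continuousOn_repr_spectrum hZ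
  have hcont' : ContinuousOn σ.repr ((fun x => c⁻¹ * x) '' spectrum ℝ Z) := by
    refine σ.continuousOn_repr.mono ?_
    rintro _ ⟨x, hx, rfl⟩
    exact mul_pos (inv_pos.2 hc0) (hz₀.trans_le (hs0 x hx))
  have hcont'' : ContinuousOn (fun x => σ.repr (c⁻¹ * x)) (spectrum ℝ Z) :=
    hcont'.comp (by fun_prop) (Set.mapsTo_image _ _)
  have e1 : σ.op (c • X) A = conjSqrt X (c • cfc σ.repr (c⁻¹ • Z)) := by
    rw [← σ.op_one_eq_cfc hcZ, ← σ.op_smul_smul zero_le_one hcZ.nonneg hc0, smul_smul,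
      mul_inv_cancel₀ hc0.ne', one_smul, conjSqrt_apply,
      σ.op_conj (smul_nonneg hc0.le zero_le_one) hZ.nonneg hX.sqrt, ← conjSqrt_apply,
      ← conjSqrt_apply, map_smul, conjSqrt_one X hX.nonneg, conjSqrt_conjSqrt_ringInverse X A hX]
  rw [e1, σ.op_eq_conjSqrt hX hA, ← map_smul (conjSqrt X)]
  refine conjSqrt_le_conjSqrt ?_
  rw [← cfc_comp_const_mul c⁻¹ σ.repr Z hcont' hZ.isSelfAdjoint, ← cfc_const_mul _ _ _ hcont'',
    ← cfc_const_mul _ _ _ hcont]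
  exact cfc_mono (fun x hx => hscal x (hs0 x hx) (hs1 x hx)) (by fun_prop) (by fun_prop)

end Strict

end OperatorMean

/-! ### Existence, uniqueness and bounds for the deformed mean. -/

section Scaling

variable {H : Type u} [NormedAddCommGroup H] [InnerProductSpace ℂ H] [CompleteSpace H]

lemma div_smul_le_smul_one {X : H →L[ℂ] H} {a b : ℝ} (ha : 0 ≤ a) (hb : 0 < b)
    (h : X ≤ b • (1 : H →L[ℂ] H)) : (a / b) • X ≤ a • (1 : H →L[ℂ] H) := by
  have := smul_le_smul_of_nonneg_left h (div_nonneg ha hb.le)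
  rwa [smul_smul, div_mul_cancel₀ _ hb.ne'] at this

lemma smul_one_le_div_smul {X : H →L[ℂ] H} {a b : ℝ} (ha : 0 < a) (hb : 0 ≤ b)
    (h : a • (1 : H →L[ℂ] H) ≤ X) : b • (1 : H →L[ℂ] H) ≤ (b / a) • X := by
  have := smul_le_smul_of_nonneg_left h (div_nonneg hb ha.le)
  rwa [smul_smul, div_mul_cancel₀ _ ha.ne'] at this

lemma le_of_smul_le_smul_of_pos {X Y : H →L[ℂ] H} {t : ℝ} (ht : 0 < t) (h : t • X ≤ t • Y) :
    X ≤ Y := by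
  have := smul_le_smul_of_nonneg_left h (inv_pos.2 ht).le
  rwa [smul_smul, smul_smul, inv_mul_cancel₀ ht.ne', one_smul, one_smul] at this

end Scaling

section Deformed

variable {n : ℕ} {H : Type u} [NormedAddCommGroup H] [InnerProductSpace ℂ H] [CompleteSpace H]

lemma MultiMean.toFun_smul (𝔐 : MultiMean n H) {A : Fin n → H →L[ℂ] H}
    (hA : ∀ j, IsStrictlyPositive (A j)) {c : ℝ} (hc : 0 < c) :
    𝔐.toFun (fun j => c • A j) = c • 𝔐.toFun A := by
  have hS := isStrictlyPositive_smul_one (H := H) (Real.sqrt_pos.2 hc)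
  have h := 𝔐.congruence A (√c • 1) hA hS.isUnit
  rw [hS.isSelfAdjoint.star_eq] at h
  simp only [smul_mul_assoc, mul_smul_comm, one_mul, mul_one, smul_smul,
    Real.mul_self_sqrt hc.le] at h
  exact h.symm

variable (𝔐 : MultiMean n H) (σ : OperatorMean.{u}) {A : Fin n → H →L[ℂ] H}

lemma toFun_op_mono (hA : ∀ j, IsStrictlyPositive (A j)) {X Y : H →L[ℂ] H}
    (hX : IsStrictlyPositive X) (hXY : X ≤ Y) :
    𝔐.toFun (fun j => σ.op X (A j)) ≤ 𝔐.toFun fun j => σ.op Y (A j) :=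
  𝔐.monotone _ _ (fun j => σ.op_isStrictlyPositive hX (hA j))
    (fun j => σ.op_isStrictlyPositive (hX.of_le hXY) (hA j))
    fun j => σ.monotone hX.nonneg (hA j).nonneg hXY le_rfl

lemma toFun_op_smul_one {c : ℝ} (hc : 0 < c) :
    𝔐.toFun (fun _ => σ.op (c • 1) (c • 1)) = c • 1 := by
  have h1 : σ.op (c • (1 : H →L[ℂ] H)) (c • 1) = c • 1 := by
    rw [σ.op_smul_smul zero_le_one zero_le_one hc, σ.normalized]
  rw [h1, 𝔐.toFun_smul (fun _ => isStrictlyPositive_one) hc, 𝔐.normalized]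

variable {m M : ℝ}

lemma smul_one_le_toFun_op (hm : 0 < m) (hmA : ∀ j, m • (1 : H →L[ℂ] H) ≤ A j)
    {X : H →L[ℂ] H} (hX : m • (1 : H →L[ℂ] H) ≤ X) :
    m • (1 : H →L[ℂ] H) ≤ 𝔐.toFun fun j => σ.op X (A j) := by
  have hm1 := isStrictlyPositive_smul_one (H := H) hm
  rw [← toFun_op_smul_one 𝔐 σ hm]
  exact 𝔐.monotone _ _ (fun _ => σ.op_isStrictlyPositive hm1 hm1)
    (fun j => σ.op_isStrictlyPositive (hm1.of_le hX) (hm1.of_le (hmA j)))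
    fun j => σ.monotone hm1.nonneg hm1.nonneg hX (hmA j)

lemma toFun_op_le_smul_one (hA : ∀ j, IsStrictlyPositive (A j)) (hM : 0 < M)
    (hAM : ∀ j, A j ≤ M • (1 : H →L[ℂ] H)) {X : H →L[ℂ] H} (hX : IsStrictlyPositive X)
    (hXM : X ≤ M • (1 : H →L[ℂ] H)) :
    (𝔐.toFun fun j => σ.op X (A j)) ≤ M • (1 : H →L[ℂ] H) := by
  have hM1 := isStrictlyPositive_smul_one (H := H) hM
  rw [← toFun_op_smul_one 𝔐 σ hM]
  exact 𝔐.monotone _ _ (fun j => σ.op_isStrictlyPositive hX (hA j))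
    (fun j => σ.op_isStrictlyPositive hM1 hM1)
    fun j => σ.monotone hX.nonneg (hA j).nonneg hXM (hAM j)

/-- Monotonicity and homogeneity of `𝔐` transport the contraction of `σ`. The rate `q` depends only
on `σ`, `z₀`, `z₁`, so it is uniform along iterations. -/
lemma exists_toFun_op_contraction (hσ : ¬ σ.IsLeftTrivial) {z₀ z₁ : ℝ} (hz₀ : 0 < z₀) (hz : z₀ ≤ z₁)
    (hA : ∀ j, IsStrictlyPositive (A j)) :
    ∃ q : ℝ, 0 ≤ q ∧ q < 1 ∧ ∀ X Y : H →L[ℂ] H, IsStrictlyPositive X → IsStrictlyPositive Y →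
      (∀ j, z₀ • X ≤ A j) → (∀ j, A j ≤ z₁ • X) → ∀ c : ℝ, 1 ≤ c → Y ≤ c • X →
      (𝔐.toFun fun j => σ.op Y (A j))
        ≤ (1 + q * (c - 1)) • 𝔐.toFun fun j => σ.op X (A j) := by
  obtain ⟨η, hη0, hη1, h⟩ := σ.exists_op_smul_le hσ hz₀ hz
  refine ⟨1 - η, by linarith, by linarith, fun X Y hX hY h0 h1 c hc hYX => ?_⟩
  have hk : 0 < 1 + (1 - η) * (c - 1) := by
    have := mul_nonneg (sub_nonneg.2 hη1) (sub_nonneg.2 hc)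
    linarith
  have hop (j) := σ.op_isStrictlyPositive hX (hA j)
  have hcX : IsStrictlyPositive (c • X) := hX.smul (by linarith)
  refine (toFun_op_mono 𝔐 σ hA hY hYX).trans ?_
  rw [← 𝔐.toFun_smul hop hk]
  exact 𝔐.monotone _ _ (fun j => σ.op_isStrictlyPositive hcX (hA j)) (fun j => (hop j).smul hk)
    fun j => h hX (hA j) (h0 j) (h1 j) c hc

lemma exists_le_smul_of_isStrictlyPositive {X Y : H →L[ℂ] H} (hX : IsStrictlyPositive X)
    (hY : IsSelfAdjoint Y) : ∃ c : ℝ, 1 ≤ c ∧ Y ≤ c • X := by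
  obtain ⟨b, hb, hYb⟩ := exists_le_smul_one hY
  obtain ⟨a, ha, haX⟩ := hX.exists_smul_one_le
  refine ⟨1 + b / a, by linarith [div_pos hb ha], hYb.trans ?_⟩
  refine (smul_one_le_div_smul ha hb.le haX).trans (smul_le_smul_of_nonneg_right (by linarith) hX.nonneg)

/-- Both operators are fixed, so `Y ≤ c X` improves itself to `Y ≤ (1 + q ^ k * (c - 1)) X` for
every `k`. -/
theorem IsDeformedSolution.le (hσ : ¬ σ.IsLeftTrivial)
    (hm : 0 < m) (hmA : ∀ j, m • (1 : H →L[ℂ] H) ≤ A j)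
    (hAM : ∀ j, A j ≤ M • (1 : H →L[ℂ] H)) {X Y : H →L[ℂ] H}
    (hX : IsDeformedSolution 𝔐 σ A X) (hY : IsDeformedSolution 𝔐 σ A Y) : Y ≤ X := by
  have hA (j) : IsStrictlyPositive (A j) := isStrictlyPositive_of_smul_one_le hm (hmA j)
  obtain ⟨hX, hXe⟩ := hX
  obtain ⟨hY, hYe⟩ := hY
  obtain ⟨b, hb, hXb⟩ := exists_le_smul_one hX.isSelfAdjoint
  obtain ⟨z, -, hz⟩ := exists_le_smul_of_isStrictlyPositive hX
    (Y := M • (1 : H →L[ℂ] H)) (IsSelfAdjoint.smul (by simp [isSelfAdjoint_iff]) (.one _))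
  have h0 (j) : (m / b) • X ≤ A j := (div_smul_le_smul_one hm.le hb hXb).trans (hmA j)
  have h1 (j) : A j ≤ (max z (m / b)) • X :=
    (hAM j).trans (hz.trans (smul_le_smul_of_nonneg_right (le_max_left _ _) hX.nonneg))
  obtain ⟨q, hq0, hq1, hq⟩ := exists_toFun_op_contraction 𝔐 σ hσ (div_pos hm hb)
    (le_max_right z _) hA
  obtain ⟨c, hc, hYc⟩ := exists_le_smul_of_isStrictlyPositive hX hY.isSelfAdjoint
  have hind (k : ℕ) : Y ≤ (1 + q ^ k * (c - 1)) • X := by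
    induction k with
    | zero => simpa using hYc
    | succ k ih =>
      have h1c : 1 ≤ 1 + q ^ k * (c - 1) := by
        have := mul_nonneg (pow_nonneg hq0 k) (sub_nonneg.2 hc)
        linarith
      have := hq X Y hX hY h0 h1 _ h1c ih
      rw [← hXe, ← hYe] at this
      convert this using 2
      ring
  have ht : Tendsto (fun k : ℕ => (1 + q ^ k * (c - 1)) • X) atTop
      (𝓝 ((1 + 0 * (c - 1)) • X)) :=
    (((tendsto_pow_atTop_nhds_zero_of_lt_one hq0 hq1).mul_const _).const_add _).smul_const _
  rw [zero_mul, add_zero, one_smul] at ht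
  exact ge_of_tendsto' ht hind

/-- A monotone self-map of the order interval `[m, M]` that contracts multiplicative perturbations
has a fixed point. -/
theorem exists_fixedPoint_of_ratio_contraction {F : (H →L[ℂ] H) → (H →L[ℂ] H)} {q : ℝ}
    (hm : 0 < m) (hmM : m ≤ M) (hq0 : 0 ≤ q) (hq1 : q < 1)
    (hFm : ∀ X, m • (1 : H →L[ℂ] H) ≤ X → m • (1 : H →L[ℂ] H) ≤ F X)
    (hFM : ∀ X, m • (1 : H →L[ℂ] H) ≤ X → X ≤ M • (1 : H →L[ℂ] H) → F X ≤ M • (1 : H →L[ℂ] H))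
    (hmono : ∀ X Y, m • (1 : H →L[ℂ] H) ≤ X → X ≤ Y → F X ≤ F Y)
    (hq : ∀ X Y, m • (1 : H →L[ℂ] H) ≤ X → X ≤ M • (1 : H →L[ℂ] H) →
      m • (1 : H →L[ℂ] H) ≤ Y → ∀ c : ℝ, 1 ≤ c → Y ≤ c • X → F Y ≤ (1 + q * (c - 1)) • F X) :
    ∃ X, m • (1 : H →L[ℂ] H) ≤ X ∧ X = F X := by
  have hM : 0 < M := hm.trans_le hmM
  -- Iteration from the top of the interval decreases; the geometric decay of consecutive ratios
  -- makes the sequence Cauchy in norm.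
  obtain ⟨x, hx0, hxs⟩ : ∃ x : ℕ → H →L[ℂ] H, x 0 = M • 1 ∧ ∀ k, x (k + 1) = F (x k) :=
    ⟨fun k => F^[k] (M • 1), rfl, fun k => Function.iterate_succ_apply' F k _⟩
  have hxm (k) : m • (1 : H →L[ℂ] H) ≤ x k := by
    induction k with
    | zero => rw [hx0]; exact smul_le_smul_of_nonneg_right hmM zero_le_one
    | succ k ih => rw [hxs]; exact hFm _ ih
  have hxM (k) : x k ≤ M • (1 : H →L[ℂ] H) := by
    induction k with
    | zero => exact hx0.le
    | succ k ih => rw [hxs]; exact hFM _ (hxm k) ih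
  have hxa (k) : x (k + 1) ≤ x k := by
    induction k with
    | zero => rw [hx0]; exact hxM 1
    | succ k ih =>
      calc x (k + 1 + 1) = F (x (k + 1)) := hxs _
        _ ≤ F (x k) := hmono _ _ (hxm _) ih
        _ = x (k + 1) := (hxs k).symm
  have hanti : Antitone x := antitone_nat_of_succ_le hxa
  have hc0 : 0 ≤ M / m - 1 := by
    rw [sub_nonneg, one_le_div hm]; exact hmM
  have hrat (k) : x k ≤ (1 + q ^ k * (M / m - 1)) • x (k + 1) := by
    induction k with
    | zero =>
      simpa [hx0] using smul_one_le_div_smul hm hM.le (hxm 1)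
    | succ k ih =>
      have h1c : 1 ≤ 1 + q ^ k * (M / m - 1) := by
        have := mul_nonneg (pow_nonneg hq0 k) hc0
        linarith
      have := hq (x (k + 1)) (x k) (hxm _) (hxM _) (hxm _) _ h1c ih
      rw [← hxs, ← hxs] at this
      convert this using 2
      ring
  have hdist (k) : dist (x k) (x (k + 1)) ≤ (M / m - 1) * M * q ^ k := by
    rw [dist_eq_norm]
    have hC : 0 ≤ (M / m - 1) * M * q ^ k := by positivity
    have hn : 0 ≤ x k - x (k + 1) := sub_nonneg.2 (hxa k)
    refine (CStarAlgebra.norm_le_iff_le_algebraMap _ hC hn).2 ?_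
    rw [Algebra.algebraMap_eq_smul_one]
    have h1 : x k - x (k + 1) ≤ (q ^ k * (M / m - 1)) • x (k + 1) := by
      rw [sub_le_iff_le_add, add_comm]
      have := hrat k
      rwa [add_smul, one_smul] at this
    refine h1.trans ((smul_le_smul_of_nonneg_left (hxM (k + 1)) (by positivity)).trans_eq ?_)
    rw [smul_smul]; congr 1; ring
  obtain ⟨X, hX⟩ := cauchySeq_tendsto_of_complete (cauchySeq_of_le_geometric q _ hq1 hdist)
  have hXm : m • (1 : H →L[ℂ] H) ≤ X := ge_of_tendsto' hX hxm
  have hXM : X ≤ M • (1 : H →L[ℂ] H) := le_of_tendsto' hX hxM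
  have hXx (k) : X ≤ x k := hanti.le_of_tendsto hX k
  have hXs : Tendsto (fun k => x (k + 1)) atTop (𝓝 X) := (tendsto_add_atTop_iff_nat 1).2 hX
  refine ⟨X, hXm, le_antisymm ?_ ?_⟩
  -- Continuity of `F` is not assumed; the ratio contraction, applied to `x k ≤ (1 + ‖x k - X‖ / m)
  -- X`, takes its place.
  · have hb (k) : x (k + 1) ≤ (1 + q * (‖x k - X‖ / m)) • F X := by
      have h1 : x k ≤ (1 + ‖x k - X‖ / m) • X := by
        have hn : IsSelfAdjoint (x k - X) := (sub_nonneg.2 (hXx k)).isSelfAdjoint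
        have h2 := hn.le_algebraMap_norm_self
        rw [Algebra.algebraMap_eq_smul_one, sub_le_iff_le_add, add_comm] at h2
        rw [add_smul, one_smul]
        refine h2.trans (add_le_add le_rfl ?_)
        exact smul_one_le_div_smul hm (norm_nonneg (x k - X)) hXm
      have := hq X (x k) hXm hXM (hxm k) _
        (by linarith [div_nonneg (norm_nonneg (x k - X)) hm.le]) h1
      rw [← hxs, add_sub_cancel_left] at this
      exact this
    have ht : Tendsto (fun k => (1 + q * (‖x k - X‖ / m)) • F X) atTop
        (𝓝 ((1 + q * (‖X - X‖ / m)) • F X)) :=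
      (((((hX.sub_const X).norm).div_const m).const_mul q).const_add 1).smul_const _
    rw [sub_self, norm_zero, zero_div, mul_zero, add_zero, one_smul] at ht
    exact le_of_tendsto_of_tendsto' hXs ht hb
  · refine ge_of_tendsto' hXs fun k => ?_
    rw [hxs]
    exact hmono _ _ hXm (hXx k)

theorem exists_isDeformedSolution (hσ : ¬ σ.IsLeftTrivial) (hm : 0 < m) (hmM : m ≤ M)
    (hmA : ∀ j, m • (1 : H →L[ℂ] H) ≤ A j) (hAM : ∀ j, A j ≤ M • (1 : H →L[ℂ] H)) :
    ∃ X, IsDeformedSolution 𝔐 σ A X := by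
  have hA (j) : IsStrictlyPositive (A j) := isStrictlyPositive_of_smul_one_le hm (hmA j)
  have hM : 0 < M := hm.trans_le hmM
  have hz : m / M ≤ M / m := by
    rw [div_le_div_iff₀ hM hm]; nlinarith
  obtain ⟨q, hq0, hq1, hq⟩ := exists_toFun_op_contraction 𝔐 σ hσ (div_pos hm hM) hz hA
  have hsp {X : H →L[ℂ] H} (h : m • (1 : H →L[ℂ] H) ≤ X) : IsStrictlyPositive X :=
    isStrictlyPositive_of_smul_one_le hm h
  have hz0 {X : H →L[ℂ] H} (h : X ≤ M • (1 : H →L[ℂ] H)) (j) : (m / M) • X ≤ A j :=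
    (div_smul_le_smul_one hm.le hM h).trans (hmA j)
  have hz1 {X : H →L[ℂ] H} (h : m • (1 : H →L[ℂ] H) ≤ X) (j) : A j ≤ (M / m) • X :=
    (hAM j).trans (smul_one_le_div_smul hm hM.le h)
  obtain ⟨X, hXm, hXe⟩ := exists_fixedPoint_of_ratio_contraction
    (F := fun X => 𝔐.toFun fun j => σ.op X (A j)) hm hmM hq0 hq1
    (fun X hX => smul_one_le_toFun_op 𝔐 σ hm hmA hX)
    (fun X hX hXM => toFun_op_le_smul_one 𝔐 σ hA hM hAM (hsp hX) hXM)
    (fun X Y hX hXY => toFun_op_mono 𝔐 σ hA (hsp hX) hXY)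
    (fun X Y hX hXM hY c hc hYX => hq X Y (hsp hX) (hsp hY) (hz0 hXM) (hz1 hX) c hc hYX)
  exact ⟨X, hsp hXm, hXe⟩

theorem existsUnique_isDeformedSolution (hσ : ¬ σ.IsLeftTrivial) (hm : 0 < m) (hmM : m ≤ M)
    (hmA : ∀ j, m • (1 : H →L[ℂ] H) ≤ A j) (hAM : ∀ j, A j ≤ M • (1 : H →L[ℂ] H)) :
    ∃! X, IsDeformedSolution 𝔐 σ A X := by
  obtain ⟨X, hX⟩ := exists_isDeformedSolution 𝔐 σ hσ hm hmM hmA hAM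
  exact ⟨X, hX, fun Y hY => le_antisymm (hX.le 𝔐 σ hσ hm hmA hAM hY)
    (hY.le 𝔐 σ hσ hm hmA hAM hX)⟩

lemma isDeformedSolution_deformedMean (h : ∃! X, IsDeformedSolution 𝔐 σ A X) :
    IsDeformedSolution 𝔐 σ A (deformedMean 𝔐 σ A) := by
  rw [deformedMean, dif_pos h]
  exact h.choose_spec.1

variable {ω : Fin n → ℝ}

/-- The equation and the support bound give `X ≤ (1 - t) X + t ∑ ωⱼ Aⱼ`, where `t > 0` cancels. -/
theorem IsDeformedSolution.le_arithMean (hσ : ¬ σ.IsLeftTrivial)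
    (hω1 : ∑ j, ω j = 1) (hω : ∀ j, 0 ≤ ω j)
    (h𝔐 : 𝔐.Between ω) (hA : ∀ j, IsStrictlyPositive (A j)) {X : H →L[ℂ] H}
    (hX : IsDeformedSolution 𝔐 σ A X) : X ≤ ∑ j, ω j • A j := by
  obtain ⟨hX, hXe⟩ := hX
  obtain ⟨t, ht, h⟩ := σ.exists_op_le hσ
  have h1 : X ≤ ∑ j, ω j • σ.op X (A j) := by
    nth_rewrite 1 [hXe]
    exact (h𝔐 _ fun j => σ.op_isStrictlyPositive hX (hA j)).2
  have h2 : ∑ j, ω j • σ.op X (A j) ≤ (1 - t) • X + t • ∑ j, ω j • A j := by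
    calc ∑ j, ω j • σ.op X (A j) ≤ ∑ j, ω j • ((1 - t) • X + t • A j) :=
          Finset.sum_le_sum fun j _ => smul_le_smul_of_nonneg_left (h hX (hA j)) (hω j)
      _ = (1 - t) • X + t • ∑ j, ω j • A j := by
          simp only [smul_add, Finset.sum_add_distrib, Finset.smul_sum, ← Finset.sum_smul, hω1,
            one_smul, smul_comm _ t]
  have h3 : t • X ≤ t • ∑ j, ω j • A j := by
    have := h1.trans h2
    rw [sub_smul, one_smul, sub_add_eq_add_sub, le_sub_iff_add_le] at this
    exact le_of_add_le_add_left this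
  exact le_of_smul_le_smul_of_pos ht h3

theorem IsDeformedSolution.inverse_le (hσ : ¬ σ.IsLeftTrivial)
    (hω1 : ∑ j, ω j = 1) (hω : ∀ j, 0 ≤ ω j)
    (h𝔐 : 𝔐.Between ω) (hA : ∀ j, IsStrictlyPositive (A j)) {X : H →L[ℂ] H}
    (hX : IsDeformedSolution 𝔐 σ A X) : Ring.inverse X ≤ ∑ j, ω j • Ring.inverse (A j) := by
  obtain ⟨hX, hXe⟩ := hX
  obtain ⟨t, ht, h⟩ := σ.exists_inverse_op_le hσ
  have hop (j) := σ.op_isStrictlyPositive hX (hA j)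
  -- Some weight is positive, so the sum is invertible and the harmonic bound on `X` can be
  -- inverted.
  have hN : IsStrictlyPositive (∑ j, ω j • Ring.inverse (σ.op X (A j))) := by
    obtain ⟨j, -, hj⟩ : ∃ j ∈ Finset.univ, 0 < ω j := by
      by_contra! hcon
      have := Finset.sum_nonpos hcon
      linarith
    refine ((hop j).ringInverse.smul hj).of_le ?_
    exact Finset.single_le_sum
      (f := fun j => ω j • Ring.inverse (σ.op X (A j)))
      (fun i _ => smul_nonneg (hω i) (hop i).ringInverse.nonneg) (Finset.mem_univ j)
  have h1 : Ring.inverse X ≤ ∑ j, ω j • Ring.inverse (σ.op X (A j)) := by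
    have h2 : Ring.inverse (∑ j, ω j • Ring.inverse (σ.op X (A j))) ≤ X := by
      nth_rewrite 2 [hXe]
      exact (h𝔐 _ hop).1
    have h3 := CStarAlgebra.ringInverse_le_ringInverse h2 hN.ringInverse
    rwa [Ring.inverse_inverse hN.isUnit] at h3
  have h2 : ∑ j, ω j • Ring.inverse (σ.op X (A j))
      ≤ (1 - t) • Ring.inverse X + t • ∑ j, ω j • Ring.inverse (A j) := by
    calc ∑ j, ω j • Ring.inverse (σ.op X (A j))
        ≤ ∑ j, ω j • ((1 - t) • Ring.inverse X + t • Ring.inverse (A j)) :=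
          Finset.sum_le_sum fun j _ => smul_le_smul_of_nonneg_left (h hX (hA j)) (hω j)
      _ = _ := by
          simp only [smul_add, Finset.sum_add_distrib, Finset.smul_sum, ← Finset.sum_smul, hω1,
            one_smul, smul_comm _ t]
  have h3 : t • Ring.inverse X ≤ t • ∑ j, ω j • Ring.inverse (A j) := by
    have := h1.trans h2
    rw [sub_smul, one_smul, sub_add_eq_add_sub, le_sub_iff_add_le] at this
    exact le_of_add_le_add_left this
  exact le_of_smul_le_smul_of_pos ht h3

end Deformed

/-! ### Chords and tangents of power functions. -/

section Chord

/-- Slope of the chord of `x ↦ x ^ p` on `[m, M]`. -/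
noncomputable def chordSlope (m M p : ℝ) : ℝ := (M ^ p - m ^ p) / (M - m)

/-- Value at `0` of the chord of `x ↦ x ^ p` on `[m, M]`. -/
noncomputable def chordIntercept (m M p : ℝ) : ℝ := (M * m ^ p - m * M ^ p) / (M - m)

variable {m M : ℝ}

lemma chord_eq (hmM : m < M) (p x : ℝ) :
    chordIntercept m M p + chordSlope m M p * x
      = (M - x) / (M - m) * m ^ p + (x - m) / (M - m) * M ^ p := by
  have : M - m ≠ 0 := by linarith
  rw [chordIntercept, chordSlope]
  field_simp
  ring

/-- Tangent line inequality for a negative power. -/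
lemma tangent_le_rpow_of_neg {p x y : ℝ} (hp : p < 0) (hx : 0 < x) (hy : 0 < y) :
    x ^ p + p * x ^ (p - 1) * (y - x) ≤ y ^ p := by
  -- From `exp u ≥ 1 + u` with `u = p log s`, and `log s ≤ s - 1` multiplied by `p < 0`.
  have h1 : 1 + p * (y / x - 1) ≤ (y / x) ^ p := by
    have hyx : 0 < y / x := div_pos hy hx
    rw [Real.rpow_def_of_pos hyx]
    have h2 := Real.add_one_le_exp (Real.log (y / x) * p)
    have h3 := Real.log_le_sub_one_of_pos hyx
    nlinarith
  have h2 := mul_le_mul_of_nonneg_left h1 (Real.rpow_pos_of_pos hx p).le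
  rw [← Real.mul_rpow hx.le (div_pos hy hx).le, mul_div_cancel₀ _ hx.ne'] at h2
  refine le_trans (le_of_eq ?_) h2
  rw [Real.rpow_sub_one hx.ne']
  field_simp

/-- Tangent line inequality for a power with exponent in `(0, 1)`. -/
lemma rpow_le_tangent {p x y : ℝ} (hp : 0 < p) (hp1 : p < 1) (hx : 0 < x) (hy : 0 < y) :
    y ^ p ≤ x ^ p + p * x ^ (p - 1) * (y - x) := by
  have hyx : 0 < y / x := div_pos hy hx
  have h1 := _root_.rpow_one_add_le_one_add_mul_self (s := y / x - 1) (by linarith) hp.le hp1.le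
  rw [add_sub_cancel] at h1
  have h2 := mul_le_mul_of_nonneg_left h1 (Real.rpow_pos_of_pos hx p).le
  rw [← Real.mul_rpow hx.le hyx.le, mul_div_cancel₀ _ hx.ne'] at h2
  refine h2.trans (le_of_eq ?_)
  rw [Real.rpow_sub_one hx.ne']
  field_simp

/-- Average the tangent inequality at `x`, evaluated at `m` and `M`, with the weights that represent
`x`; the linear terms cancel. -/
lemma rpow_le_chord {p x : ℝ} (hp : p < 0) (hm : 0 < m) (hmM : m < M) (hmx : m ≤ x)
    (hxM : x ≤ M) : x ^ p ≤ chordIntercept m M p + chordSlope m M p * x := by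
  rw [chord_eq hmM]
  have hd : 0 < M - m := by linarith
  have hx : 0 < x := by linarith
  have h1 := mul_le_mul_of_nonneg_left (tangent_le_rpow_of_neg hp hx hm)
    (div_nonneg (sub_nonneg.2 hxM) hd.le)
  have h2 := mul_le_mul_of_nonneg_left (tangent_le_rpow_of_neg hp hx (hm.trans hmM))
    (div_nonneg (sub_nonneg.2 hmx) hd.le)
  refine le_trans (le_of_eq ?_) (add_le_add h1 h2)
  field_simp
  ring

lemma chord_le_rpow {p x : ℝ} (hp : 0 < p) (hp1 : p < 1) (hm : 0 < m) (hmM : m < M) (hmx : m ≤ x)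
    (hxM : x ≤ M) : chordIntercept m M p + chordSlope m M p * x ≤ x ^ p := by
  rw [chord_eq hmM]
  have hd : 0 < M - m := by linarith
  have hx : 0 < x := by linarith
  have h1 := mul_le_mul_of_nonneg_left (rpow_le_tangent hp hp1 hx hm)
    (div_nonneg (sub_nonneg.2 hxM) hd.le)
  have h2 := mul_le_mul_of_nonneg_left (rpow_le_tangent hp hp1 hx (hm.trans hmM))
    (div_nonneg (sub_nonneg.2 hmx) hd.le)
  refine (add_le_add h1 h2).trans (le_of_eq ?_)
  field_simp
  ring

lemma chordSlope_neg {p : ℝ} (hp : p < 0) (hm : 0 < m) (hmM : m < M) : chordSlope m M p < 0 :=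
  div_neg_of_neg_of_pos (sub_neg.2 (Real.rpow_lt_rpow_of_neg hm hmM hp)) (by linarith)

lemma chordSlope_pos {p : ℝ} (hp : 0 < p) (hm : 0 < m) (hmM : m < M) : 0 < chordSlope m M p :=
  div_pos (sub_pos.2 (Real.rpow_lt_rpow hm.le hmM hp)) (by linarith)

/-- The chord exceeds a negative power by at most the constant `γ`. -/
lemma chord_le_rpow_add_gammaConst {p x : ℝ} (hp : p < 0) (hm : 0 < m) (hmM : m < M)
    (hx : 0 < x) :
    chordIntercept m M p + chordSlope m M p * x ≤ x ^ p + gammaConst m M p 1 := by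
  -- The mean value point `c`, where the tangent is parallel to the chord, is exactly `t₀`. It lies
  -- inside `(m, M)`, so only the first branch of `γ` occurs when `α = 1`.
  obtain ⟨c, ⟨hmc, hcM⟩, hc⟩ := exists_hasDerivAt_eq_slope (fun x : ℝ => x ^ p)
    (fun x => p * x ^ (p - 1)) hmM
    (fun y hy => (Real.continuousAt_rpow_const y p (Or.inl (by linarith [hy.1]))).continuousWithinAt)
    (fun y hy => Real.hasDerivAt_rpow_const (Or.inl (by linarith [hy.1])))
  have hc0 : 0 < c := hm.trans hmc
  have hslope : p * c ^ (p - 1) = chordSlope m M p := hc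
  have hbase : (M ^ p - m ^ p) / (1 * p * (M - m)) = c ^ (p - 1) := by
    have hd : M - m ≠ 0 := by linarith
    rw [chordSlope] at hslope
    rw [one_mul, mul_comm p, ← div_div, ← hslope, mul_div_cancel_left₀ _ hp.ne]
  have hp1 : p - 1 ≠ 0 := by linarith
  have ht : (c ^ (p - 1)) ^ (1 / (p - 1)) = c := by
    rw [← Real.rpow_mul hc0.le, mul_one_div_cancel hp1, Real.rpow_one]
  have ht' : (c ^ (p - 1)) ^ (p / (p - 1)) = c ^ p := by
    rw [← Real.rpow_mul hc0.le, mul_div_cancel₀ _ hp1]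
  have hγ : gammaConst m M p 1 = (p - 1) * c ^ p + chordIntercept m M p := by
    simp only [gammaConst, hbase, ht, ht']
    rw [if_pos ⟨hmc.le, hcM.le⟩, one_mul, chordIntercept]
  have htan := tangent_le_rpow_of_neg hp hc0 hx
  rw [hslope] at htan
  have h1 : chordSlope m M p * c = p * c ^ p := by
    rw [← hslope, Real.rpow_sub_one hc0.ne']; field_simp
  rw [hγ]
  linarith

/-- The ratio of the chord to a negative power is at most the Kantorovich constant. -/
lemma chord_le_kantorovichConst_mul {p x : ℝ} (hp : p < 0) (hm : 0 < m) (hmM : m < M)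
    (hx : 0 < x) :
    chordIntercept m M p + chordSlope m M p * x ≤ kantorovichConst (M / m) p * x ^ p := by
  have hM : 0 < M := hm.trans hmM
  set h := M / m with hh
  have hh1 : 1 < h := (one_lt_div hm).2 hmM
  have hMh : M = h * m := by rw [hh, div_mul_cancel₀ _ hm.ne']
  have hhp1 : h ^ p < 1 := Real.rpow_lt_one_of_one_lt_of_neg hh1 hp
  have hh0 : 0 < h := by linarith
  have hMp : M ^ p = h ^ p * m ^ p := by rw [hMh, Real.mul_rpow hh0.le hm.le]
  have hmp : 0 < m ^ p := Real.rpow_pos_of_pos hm p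
  set R := (p - 1) / p * ((h ^ p - 1) / (h ^ p - h)) with hR
  have hRpos : 0 < R := by
    apply mul_pos (div_pos_of_neg_of_neg (by linarith) hp)
    exact div_pos_of_neg_of_neg (by linarith) (by linarith)
  -- At `x₁` the curve `κ * x ^ p` touches the chord line: `hslope` and `hval` match slope and
  -- value, and the tangent inequality finishes.
  set x₁ := m / R with hx₁
  have hx₁0 : 0 < x₁ := div_pos hm hRpos
  set κ := kantorovichConst h p with hκ
  have hα : chordSlope m M p = m ^ p * (h ^ p - 1) / (m * (h - 1)) := by
    rw [chordSlope, hMp, hMh]; congr 1 <;> ring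
  have hβ : chordIntercept m M p = m ^ p * (h - h ^ p) / (h - 1) := by
    rw [chordIntercept, hMp, hMh]
    rw [show h * m * m ^ p - m * (h ^ p * m ^ p) = m * (m ^ p * (h - h ^ p)) by ring,
      show h * m - m = m * (h - 1) by ring, mul_div_mul_left _ _ hm.ne']
  have h1 : h - 1 ≠ 0 := by linarith
  have h2 : h ^ p - h ≠ 0 := by linarith
  have h3 : h ^ p - 1 ≠ 0 := by linarith
  have h4 : p - 1 ≠ 0 := by linarith
  have hx₁p : x₁ ^ p * R ^ p = m ^ p := by
    rw [← Real.mul_rpow hx₁0.le hRpos.le, hx₁, div_mul_cancel₀ _ hRpos.ne']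
  have hκx : κ * x₁ ^ p = (h ^ p - h) / ((p - 1) * (h - 1)) * m ^ p := by
    rw [hκ, kantorovichConst, ← hR, ← hx₁p]; ring
  have hκ0 : 0 < κ := by
    rw [hκ, kantorovichConst, ← hR]
    apply mul_pos _ (Real.rpow_pos_of_pos hRpos p)
    exact div_pos_of_neg_of_neg (by linarith)
      (mul_neg_of_neg_of_pos (by linarith) (by linarith))
  have hslope : κ * (p * x₁ ^ (p - 1)) = chordSlope m M p := by
    rw [Real.rpow_sub_one hx₁0.ne', show κ * (p * (x₁ ^ p / x₁)) = (κ * x₁ ^ p) * p / x₁ by ring,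
      hκx, hα, hx₁, hR]
    have hp0 := hp.ne
    field_simp
  have hval : κ * x₁ ^ p = chordIntercept m M p + chordSlope m M p * x₁ := by
    rw [hκx, hα, hβ, hx₁, hR]
    have hp0 := hp.ne
    field_simp
    ring
  have htan := mul_le_mul_of_nonneg_left (tangent_le_rpow_of_neg hp hx₁0 hx) hκ0.le
  have e : κ * (x₁ ^ p + p * x₁ ^ (p - 1) * (x - x₁))
      = κ * x₁ ^ p + κ * (p * x₁ ^ (p - 1)) * (x - x₁) := by ring
  rw [e, hslope, hval] at htan
  linarith

lemma kantorovichConst_pos {p : ℝ} (hp : p < 0) (hm : 0 < m) (hmM : m < M) :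
    0 < kantorovichConst (M / m) p := by
  have h1 := chord_le_kantorovichConst_mul hp hm hmM hm
  have h2 := rpow_le_chord hp hm hmM le_rfl hmM.le
  have h3 := Real.rpow_pos_of_pos hm p
  nlinarith

/-- With `u = m ^ r`, `w = M ^ r` and weights `a, b`, one has `(a u + b w)(a / u + b / w) ≥ 1`. The
second factor is the chord of `x ^ (-r)`, already bounded by `K * x ^ (-r)`. -/
lemma inv_kantorovichConst_mul_rpow_le_chord {r x : ℝ} (hr : 0 < r) (hm : 0 < m) (hmM : m < M)
    (hmx : m ≤ x) (hxM : x ≤ M) :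
    (kantorovichConst (M / m) (-r))⁻¹ * x ^ r ≤ chordIntercept m M r + chordSlope m M r * x := by
  have hx : 0 < x := by linarith
  have hM : 0 < M := by linarith
  have hκ := kantorovichConst_pos (neg_neg_of_pos hr) hm hmM
  have h1 := chord_le_kantorovichConst_mul (neg_neg_of_pos hr) hm hmM hx
  rw [chord_eq hmM] at h1 ⊢
  rw [Real.rpow_neg hm.le, Real.rpow_neg hM.le, Real.rpow_neg hx.le] at h1
  have hd : 0 < M - m := by linarith
  have ha : 0 ≤ (M - x) / (M - m) := div_nonneg (by linarith) hd.le
  have hb : 0 ≤ (x - m) / (M - m) := div_nonneg (by linarith) hd.le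
  have hab : (M - x) / (M - m) + (x - m) / (M - m) = 1 := by field_simp; ring
  have hu := Real.rpow_pos_of_pos hm r
  have hw := Real.rpow_pos_of_pos hM r
  have hy := Real.rpow_pos_of_pos hx r
  set a := (M - x) / (M - m)
  set b := (x - m) / (M - m)
  set u := m ^ r
  set w := M ^ r
  set y := x ^ r
  set κ := kantorovichConst (M / m) (-r)
  have hprod : 1 ≤ (a * u + b * w) * (a * u⁻¹ + b * w⁻¹) := by
    have e : (a * u + b * w) * (a * u⁻¹ + b * w⁻¹) = (a + b) ^ 2 + a * b * (u - w) ^ 2 / (u * w) := by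
      field_simp
      ring
    rw [e, hab]
    have : 0 ≤ a * b * (u - w) ^ 2 / (u * w) := by positivity
    linarith
  have hsum : 0 ≤ a * u + b * w := by positivity
  have h2 := mul_le_mul_of_nonneg_left h1 hsum
  have h3 : 1 ≤ (a * u + b * w) * (κ * y⁻¹) := hprod.trans h2
  rw [inv_mul_le_iff₀ hκ]
  have h4 := mul_le_mul_of_nonneg_right h3 hy.le
  calc y = 1 * y := (one_mul y).symm
    _ ≤ (a * u + b * w) * (κ * y⁻¹) * y := h4
    _ = κ * (a * u + b * w) := by field_simp

/-- Kantorovich-type constants of powers with exponent in `(0, 1)` are larger. -/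
lemma kantorovich_ratio_le_rpow {r : ℝ} (hr1 : r ≤ 1) (hr : 0 ≤ r) (hm : 0 < m) (hmM : m < M) :
    4 * M * m / (M + m) ^ 2 ≤ 4 * (M ^ r * m ^ r) / (M ^ r + m ^ r) ^ 2 := by
  have hM : 0 < M := hm.trans hmM
  have hu := Real.rpow_pos_of_pos hm r
  have hw := Real.rpow_pos_of_pos hM r
  have huw : m ^ r ≤ M ^ r := Real.rpow_le_rpow hm.le hmM.le hr
  have h1 : M ^ r * m ≤ m ^ r * M := by
    have h2 : m ^ (1 - r) ≤ M ^ (1 - r) := Real.rpow_le_rpow hm.le hmM.le (by linarith)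
    have e1 : m = m ^ r * m ^ (1 - r) := by
      rw [← Real.rpow_add hm, add_sub_cancel, Real.rpow_one]
    have e2 : M = M ^ r * M ^ (1 - r) := by
      rw [← Real.rpow_add hM, add_sub_cancel, Real.rpow_one]
    calc M ^ r * m = M ^ r * (m ^ r * m ^ (1 - r)) := by rw [← e1]
      _ ≤ M ^ r * (m ^ r * M ^ (1 - r)) := by gcongr
      _ = m ^ r * (M ^ r * M ^ (1 - r)) := by ring
      _ = m ^ r * M := by rw [← e2]
  rw [div_le_div_iff₀ (by positivity) (by positivity)]
  set u := m ^ r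
  set w := M ^ r
  -- This product equals `u w (M + m)² - M m (w + u)²`.
  have h2 : 0 ≤ (u * M - w * m) * (w * M - u * m) :=
    mul_nonneg (by linarith) (by nlinarith)
  nlinarith

end Chord

/-! ### Operator forms of the scalar inequalities and bounds for arithmetic means. -/

section PowerBounds

variable {n : ℕ}
    {H : Type u} [NormedAddCommGroup H] [InnerProductSpace ℂ H] [CompleteSpace H]
    {K : Type u} [NormedAddCommGroup K] [InnerProductSpace ℂ K] [CompleteSpace K]

lemma IsStrictlyPositive.continuousOn_rpow {Z : H →L[ℂ] H} (hZ : IsStrictlyPositive Z) (r : ℝ) :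
    ContinuousOn (fun x : ℝ => x ^ r) (spectrum ℝ Z) :=
  fun x hx => (Real.continuousAt_rpow_const x r
    (Or.inl (hZ.spectrum_real_pos x hx).ne')).continuousWithinAt

lemma rpow_le_affine_inverse {Z : H →L[ℂ] H} (hZ : IsStrictlyPositive Z) {r α β : ℝ}
    (h : ∀ x ∈ spectrum ℝ Z, x ^ r ≤ β + α * x⁻¹) :
    Z ^ r ≤ β • 1 + α • Ring.inverse Z := by
  rw [CFC.rpow_eq_cfc_real hZ.nonneg, ← cfc_affine_inv α β hZ]
  exact cfc_mono h (hZ.continuousOn_rpow r)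
    (continuousOn_const.add (hZ.continuousOn_inv.const_smul α))

lemma affine_inverse_le_smul_rpow_add {Z : H →L[ℂ] H} (hZ : IsStrictlyPositive Z)
    {r α β κ γ : ℝ} (h : ∀ x ∈ spectrum ℝ Z, β + α * x⁻¹ ≤ γ + κ * x ^ r) :
    β • 1 + α • Ring.inverse Z ≤ γ • 1 + κ • Z ^ r := by
  have h1 := hZ.continuousOn_rpow r
  have h2 : ContinuousOn (fun x : ℝ => κ * x ^ r) (spectrum ℝ Z) := h1.const_smul κ
  have e : γ • 1 + κ • Z ^ r = cfc (fun x : ℝ => γ + κ * x ^ r) Z := by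
    rw [cfc_const_add γ (fun x => κ * x ^ r) Z h2 hZ.isSelfAdjoint,
      cfc_const_mul κ (fun x => x ^ r) Z h1, ← CFC.rpow_eq_cfc_real hZ.nonneg,
      Algebra.algebraMap_eq_smul_one]
  rw [e, ← cfc_affine_inv α β hZ]
  exact cfc_mono h (continuousOn_const.add (hZ.continuousOn_inv.const_smul α))
    (continuousOn_const.add h2)

lemma affine_le_rpow {Z : H →L[ℂ] H} (hZ : IsStrictlyPositive Z) {r α β : ℝ}
    (h : ∀ x ∈ spectrum ℝ Z, β + α * x ≤ x ^ r) : β • 1 + α • Z ≤ Z ^ r := by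
  rw [CFC.rpow_eq_cfc_real hZ.nonneg, ← cfc_affine α β hZ.isSelfAdjoint]
  exact cfc_mono h (by fun_prop) (hZ.continuousOn_rpow r)

lemma smul_rpow_le_affine {Z : H →L[ℂ] H} (hZ : IsStrictlyPositive Z) {r α β κ : ℝ}
    (h : ∀ x ∈ spectrum ℝ Z, κ * x ^ r ≤ β + α * x) : κ • Z ^ r ≤ β • 1 + α • Z := by
  have h1 := hZ.continuousOn_rpow r
  rw [CFC.rpow_eq_cfc_real hZ.nonneg, ← cfc_affine α β hZ.isSelfAdjoint,
    ← cfc_const_mul κ (fun x => x ^ r) Z h1]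
  exact cfc_mono h (h1.const_smul κ) (by fun_prop)

lemma smul_one_le_rpow {Z : H →L[ℂ] H} {m r : ℝ} (hm : 0 < m) (hr : 0 ≤ r)
    (h : m • (1 : H →L[ℂ] H) ≤ Z) : m ^ r • (1 : H →L[ℂ] H) ≤ Z ^ r := by
  have hZ := isStrictlyPositive_of_smul_one_le hm h
  have := affine_le_rpow hZ (r := r) (α := 0) (β := m ^ r) fun x hx => by
    rw [zero_mul, add_zero]
    exact Real.rpow_le_rpow hm.le (le_spectrum_of_smul_one_le hZ.isSelfAdjoint h x hx) hr
  simpa using this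

lemma rpow_le_smul_one {Z : H →L[ℂ] H} {M r : ℝ} (hZ : IsStrictlyPositive Z) (hr : 0 ≤ r)
    (h : Z ≤ M • (1 : H →L[ℂ] H)) : Z ^ r ≤ M ^ r • (1 : H →L[ℂ] H) := by
  have := rpow_le_affine_inverse hZ (r := r) (α := 0) (β := M ^ r) fun x hx => by
    rw [zero_mul, add_zero]
    exact Real.rpow_le_rpow (hZ.spectrum_real_pos x hx).le
      (spectrum_le_of_le_smul_one hZ.isSelfAdjoint h x hx) hr
  simpa using this

lemma inverse_le_affine {Z : H →L[ℂ] H} {m M : ℝ} (hm : 0 < m) (hmM : m ≤ M)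
    (h0 : m • (1 : H →L[ℂ] H) ≤ Z) (h1 : Z ≤ M • (1 : H →L[ℂ] H)) :
    Ring.inverse Z ≤ ((M + m) / (M * m)) • 1 - (1 / (M * m)) • Z := by
  have hZ := isStrictlyPositive_of_smul_one_le hm h0
  have hM := hm.trans_le hmM
  have e1 := cfc_affine_inv 1 0 hZ
  have e2 := cfc_affine (-(1 / (M * m))) ((M + m) / (M * m)) hZ.isSelfAdjoint
  rw [zero_smul, one_smul, zero_add] at e1
  rw [neg_smul, ← sub_eq_add_neg] at e2
  rw [← e1, ← e2]
  refine cfc_mono (fun x hx => ?_) (continuousOn_const.add (hZ.continuousOn_inv.const_smul (1 : ℝ)))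
    (by fun_prop)
  have hx0 := hZ.spectrum_real_pos x hx
  have h2 := le_spectrum_of_smul_one_le hZ.isSelfAdjoint h0 x hx
  have h3 := spectrum_le_of_le_smul_one hZ.isSelfAdjoint h1 x hx
  have h4 : (M + m) / (M * m) + -(1 / (M * m)) * x - (0 + 1 * x⁻¹)
      = (M - x) * (x - m) / (M * m * x) := by
    field_simp
    ring
  have h5 : 0 ≤ (M - x) * (x - m) / (M * m * x) :=
    div_nonneg (mul_nonneg (by linarith) (by linarith)) (by positivity)
  linarith

/-- This is `(x - θ)² / x ≥ 0`. The free `θ` turns an upper bound on `Z⁻¹` into a lower bound on `Z`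
without inverting the bound. -/
lemma two_smul_sub_smul_inverse_le {Z : H →L[ℂ] H} (hZ : IsStrictlyPositive Z) (θ : ℝ) :
    (2 * θ) • 1 - θ ^ 2 • Ring.inverse Z ≤ Z := by
  have e1 := cfc_affine_inv (-θ ^ 2) (2 * θ) hZ
  rw [neg_smul, ← sub_eq_add_neg] at e1
  rw [← e1]
  conv_rhs => rw [← cfc_id' ℝ Z hZ.isSelfAdjoint]
  refine cfc_mono (fun x hx => ?_)
    (continuousOn_const.add (hZ.continuousOn_inv.const_smul (-θ ^ 2))) (by fun_prop)
  have hx0 := hZ.spectrum_real_pos x hx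
  have h1 : x - (2 * θ + -θ ^ 2 * x⁻¹) = (x - θ) ^ 2 / x := by
    field_simp
    ring
  have h2 : 0 ≤ (x - θ) ^ 2 / x := by positivity
  linarith

lemma inverse_le_inv_smul_one {Z : H →L[ℂ] H} {m : ℝ} (hm : 0 < m)
    (h : m • (1 : H →L[ℂ] H) ≤ Z) : Ring.inverse Z ≤ m⁻¹ • (1 : H →L[ℂ] H) := by
  have hZ := isStrictlyPositive_of_smul_one_le hm h
  have := affine_inverse_le_smul_rpow_add hZ (r := 1) (α := 1) (β := 0) (κ := 0) (γ := m⁻¹)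
    fun x hx => by
      have := inv_anti₀ hm (le_spectrum_of_smul_one_le hZ.isSelfAdjoint h x hx)
      linarith
  simpa using this

lemma smul_one_le_of_inverse_le {Z : H →L[ℂ] H} (hZ : IsStrictlyPositive Z) {m : ℝ} (hm : 0 < m)
    (h : Ring.inverse Z ≤ m⁻¹ • (1 : H →L[ℂ] H)) : m • (1 : H →L[ℂ] H) ≤ Z := by
  refine le_trans ?_ (two_smul_sub_smul_inverse_le hZ m)
  have h2 := smul_le_smul_of_nonneg_left h (sq_nonneg m)
  refine le_trans (le_of_eq ?_) (sub_le_sub_left h2 _)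
  rw [smul_smul, ← sub_smul]
  congr 1
  field_simp
  ring

lemma positiveMap_real_smul (Φ : (H →L[ℂ] H) →ₚ[ℂ] (K →L[ℂ] K)) (c : ℝ) (X : H →L[ℂ] H) :
    Φ (c • X) = c • Φ X := by
  rw [← Complex.coe_smul c X, map_smul, Complex.coe_smul]

lemma positiveMap_mono (Φ : (H →L[ℂ] H) →ₚ[ℂ] (K →L[ℂ] K)) {X Y : H →L[ℂ] H} (h : X ≤ Y) :
    Φ X ≤ Φ Y := OrderHomClass.mono Φ h

variable {ω : Fin n → ℝ} {A : Fin n → H →L[ℂ] H} {m M r : ℝ}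

/-- Upper bound for the arithmetic mean of `Φ (A j ^ r)` in terms of any `X` whose inverse is
dominated by the arithmetic mean of the inverses of the `A j`. -/
lemma sum_map_rpow_le (hω : ∀ j, 0 ≤ ω j) (hω1 : ∑ j, ω j = 1) (hm : 0 < m) (hmM : m < M)
    (hmA : ∀ j, m • (1 : H →L[ℂ] H) ≤ A j) (hAM : ∀ j, A j ≤ M • (1 : H →L[ℂ] H))
    (Φ : (H →L[ℂ] H) →ₚ[ℂ] (K →L[ℂ] K)) (hr : 0 < r) {X : H →L[ℂ] H}
    (hXA : Ring.inverse X ≤ ∑ j, ω j • Ring.inverse (A j)) :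
    ∑ j, ω j • Φ (A j ^ r) ≤ Φ (chordIntercept (1 / M) (1 / m) (-r) • 1
      + chordSlope (1 / M) (1 / m) (-r) • Ring.inverse X) := by
  have hM := hm.trans hmM
  have hA (j) : IsStrictlyPositive (A j) := isStrictlyPositive_of_smul_one_le hm (hmA j)
  have hlt : 1 / M < 1 / m := one_div_lt_one_div_of_lt hm hmM
  have hM0 : 0 < 1 / M := by positivity
  set α := chordSlope (1 / M) (1 / m) (-r)
  set β := chordIntercept (1 / M) (1 / m) (-r)
  have hα : α < 0 := chordSlope_neg (neg_neg_of_pos hr) hM0 hlt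
  have h1 (j) : A j ^ r ≤ β • 1 + α • Ring.inverse (A j) := by
    refine rpow_le_affine_inverse (hA j) fun x hx => ?_
    have hx0 := (hA j).spectrum_real_pos x hx
    have h2 := le_spectrum_of_smul_one_le (hA j).isSelfAdjoint (hmA j) x hx
    have h3 := spectrum_le_of_le_smul_one (hA j).isSelfAdjoint (hAM j) x hx
    have h4 := rpow_le_chord (x := x⁻¹) (neg_neg_of_pos hr) hM0 hlt
      (by rw [one_div]; exact inv_anti₀ hx0 h3) (by rw [one_div]; exact inv_anti₀ hm h2)
    rwa [Real.rpow_neg (inv_pos.2 hx0).le, Real.inv_rpow hx0.le, inv_inv] at h4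
  have e : ∑ j, ω j • Φ (A j ^ r) = Φ (∑ j, ω j • A j ^ r) := by
    rw [map_sum]
    simp only [positiveMap_real_smul]
  rw [e]
  refine positiveMap_mono Φ ?_
  calc ∑ j, ω j • A j ^ r ≤ ∑ j, ω j • (β • 1 + α • Ring.inverse (A j)) :=
        Finset.sum_le_sum fun j _ => smul_le_smul_of_nonneg_left (h1 j) (hω j)
    _ = β • 1 + α • ∑ j, ω j • Ring.inverse (A j) := by
        simp only [smul_add, Finset.sum_add_distrib, Finset.smul_sum, ← Finset.sum_smul, hω1,
          one_smul, smul_comm _ α]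
    _ ≤ β • 1 + α • Ring.inverse X := by
        have h2 := smul_le_smul_of_nonneg_left hXA (neg_pos.2 hα).le
        rw [neg_smul, neg_smul, neg_le_neg_iff] at h2
        exact add_le_add le_rfl h2

/-- Lower bound for the arithmetic mean of `A j ^ r`. -/
lemma smul_rpow_le_sum_rpow (hω : ∀ j, 0 ≤ ω j) (hω1 : ∑ j, ω j = 1) (hm : 0 < m) (hmM : m < M)
    (hmA : ∀ j, m • (1 : H →L[ℂ] H) ≤ A j) (hAM : ∀ j, A j ≤ M • (1 : H →L[ℂ] H))
    (hr : 0 < r) (hr1 : r < 1) {X : H →L[ℂ] H} (hXA : X ≤ ∑ j, ω j • A j)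
    (hmX : m • (1 : H →L[ℂ] H) ≤ X) (hXM : X ≤ M • (1 : H →L[ℂ] H)) :
    (kantorovichConst (M / m) (-r))⁻¹ • X ^ r ≤ ∑ j, ω j • A j ^ r := by
  have hA (j) : IsStrictlyPositive (A j) := isStrictlyPositive_of_smul_one_le hm (hmA j)
  have hX : IsStrictlyPositive X := isStrictlyPositive_of_smul_one_le hm hmX
  have hα := chordSlope_pos hr hm hmM
  set α := chordSlope m M r
  set β := chordIntercept m M r
  calc (kantorovichConst (M / m) (-r))⁻¹ • X ^ r ≤ β • 1 + α • X :=
        smul_rpow_le_affine hX fun x hx => inv_kantorovichConst_mul_rpow_le_chord hr hm hmM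
          (le_spectrum_of_smul_one_le hX.isSelfAdjoint hmX x hx)
          (spectrum_le_of_le_smul_one hX.isSelfAdjoint hXM x hx)
    _ ≤ β • 1 + α • ∑ j, ω j • A j := add_le_add le_rfl (smul_le_smul_of_nonneg_left hXA hα.le)
    _ = ∑ j, ω j • (β • 1 + α • A j) := by
        simp only [smul_add, Finset.sum_add_distrib, Finset.smul_sum, ← Finset.sum_smul, hω1,
          one_smul, smul_comm _ α]
    _ ≤ ∑ j, ω j • A j ^ r :=
        Finset.sum_le_sum fun j _ => smul_le_smul_of_nonneg_left
          (affine_le_rpow (hA j) fun x hx => chord_le_rpow hr hr1 hm hmM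
            (le_spectrum_of_smul_one_le (hA j).isSelfAdjoint (hmA j) x hx)
            (spectrum_le_of_le_smul_one (hA j).isSelfAdjoint (hAM j) x hx)) (hω j)

/-- A Kantorovich-type bound of `Y` from below by the arithmetic mean of the `B j`, when the inverse
of `Y` is dominated by the arithmetic mean of the inverses of the `B j`. -/
lemma smul_sum_le_of_inverse_le (hω : ∀ j, 0 ≤ ω j) (hω1 : ∑ j, ω j = 1) (hm : 0 < m) (hmM : m ≤ M)
    (hmA : ∀ j, m • (1 : H →L[ℂ] H) ≤ A j) (hAM : ∀ j, A j ≤ M • (1 : H →L[ℂ] H))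
    {Y : H →L[ℂ] H} (hY : IsStrictlyPositive Y)
    (hYA : Ring.inverse Y ≤ ∑ j, ω j • Ring.inverse (A j)) :
    (4 * (M * m) / (M + m) ^ 2) • ∑ j, ω j • A j ≤ Y := by
  have hM := hm.trans_le hmM
  have h1 : Ring.inverse Y ≤ ((M + m) / (M * m)) • 1 - (1 / (M * m)) • ∑ j, ω j • A j := by
    refine hYA.trans ?_
    calc ∑ j, ω j • Ring.inverse (A j)
        ≤ ∑ j, ω j • (((M + m) / (M * m)) • (1 : H →L[ℂ] H) - (1 / (M * m)) • A j) :=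
          Finset.sum_le_sum fun j _ => smul_le_smul_of_nonneg_left
            (inverse_le_affine hm hmM (hmA j) (hAM j)) (hω j)
      _ = _ := by
          simp only [smul_sub, Finset.sum_sub_distrib, Finset.smul_sum, ← Finset.sum_smul, hω1,
            one_smul, smul_comm _ (1 / (M * m))]
  set S := ∑ j, ω j • A j
  -- Chosen so that the scalar part `2 θ - θ² (M + m) / (M m)` vanishes, leaving a pure multiple of
  -- the arithmetic mean.
  set θ := 2 * (M * m) / (M + m) with hθ
  refine le_trans ?_ (two_smul_sub_smul_inverse_le hY θ)
  have h2 := smul_le_smul_of_nonneg_left h1 (sq_nonneg θ)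
  refine le_trans (le_of_eq ?_) (sub_le_sub_left h2 _)
  rw [smul_sub, smul_smul, smul_smul, ← sub_add, ← sub_smul]
  have e1 : 2 * θ - θ ^ 2 * ((M + m) / (M * m)) = 0 := by rw [hθ]; field_simp; ring
  have e2 : θ ^ 2 * (1 / (M * m)) = 4 * (M * m) / (M + m) ^ 2 := by rw [hθ]; field_simp; ring
  rw [e1, e2, zero_smul, zero_add]

end PowerBounds

/-! ### The corollary. -/

theorem corollary3p4 {n : ℕ}
    {H : Type u} [NormedAddCommGroup H] [InnerProductSpace ℂ H] [CompleteSpace H]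
    {K : Type u} [NormedAddCommGroup K] [InnerProductSpace ℂ K] [CompleteSpace K]
    (ω : Fin n → ℝ) (hω : ∀ j, 0 ≤ ω j) (hω1 : ∑ j, ω j = 1)
    (𝔐 : MultiMean n H) (h𝔐 : 𝔐.Between ω)
    (𝔐' : MultiMean n K) (h𝔐' : 𝔐'.Between ω)
    (σ : OperatorMean.{u}) (hσ : ¬ σ.IsLeftTrivial)
    (m M : ℝ) (hm : 0 < m) (hmM : m < M)
    (A : Fin n → H →L[ℂ] H) (hA : ∀ j, IsStrictlyPositive (A j))
    (hmA : ∀ j, m • (1 : H →L[ℂ] H) ≤ A j) (hAM : ∀ j, A j ≤ M • (1 : H →L[ℂ] H))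
    (Φ : (H →L[ℂ] H) →ₚ[ℂ] (K →L[ℂ] K)) (hΦ : Φ 1 = 1)
    (r : ℝ) (hr0 : 0 < r) (hr1 : r < 1) :
    (∃! X, IsDeformedSolution 𝔐 σ A X) ∧
    (∃! Y, IsDeformedSolution 𝔐' σ (fun j => Φ (A j ^ r)) Y) ∧
    deformedMean 𝔐' σ (fun j => Φ (A j ^ r)) - Φ (deformedMean 𝔐 σ A ^ r)
      ≤ gammaConst (1 / M) (1 / m) (-r) 1 • (1 : K →L[ℂ] K) ∧
    (4 * M * m / (M + m) ^ 2 * (kantorovichConst (M / m) (-r))⁻¹) • Φ (deformedMean 𝔐 σ A ^ r)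
      ≤ deformedMean 𝔐' σ (fun j => Φ (A j ^ r)) ∧
    deformedMean 𝔐' σ (fun j => Φ (A j ^ r))
      ≤ kantorovichConst (M / m) (-r) • Φ (deformedMean 𝔐 σ A ^ r) := by
  have hM : 0 < M := hm.trans hmM
  have hmr : 0 < m ^ r := Real.rpow_pos_of_pos hm r
  have hmMr : m ^ r ≤ M ^ r := Real.rpow_le_rpow hm.le hmM.le hr0.le
  have hmB (j) : m ^ r • (1 : K →L[ℂ] K) ≤ Φ (A j ^ r) := by
    have := positiveMap_mono Φ (smul_one_le_rpow hm hr0.le (hmA j))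
    rwa [positiveMap_real_smul, hΦ] at this
  have hBM (j) : Φ (A j ^ r) ≤ M ^ r • (1 : K →L[ℂ] K) := by
    have := positiveMap_mono Φ (rpow_le_smul_one (hA j) hr0.le (hAM j))
    rwa [positiveMap_real_smul, hΦ] at this
  have hB (j) : IsStrictlyPositive (Φ (A j ^ r)) := isStrictlyPositive_of_smul_one_le hmr (hmB j)
  have hEX := existsUnique_isDeformedSolution 𝔐 σ hσ hm hmM.le hmA hAM
  have hEY := existsUnique_isDeformedSolution 𝔐' σ hσ hmr hmMr hmB hBM
  have hX := isDeformedSolution_deformedMean 𝔐 σ hEX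
  have hY := isDeformedSolution_deformedMean 𝔐' σ hEY
  refine ⟨hEX, hEY, ?_⟩
  generalize deformedMean 𝔐 σ A = X at hX
  generalize deformedMean 𝔐' σ (fun j => Φ (A j ^ r)) = Y at hY
  have hXA := hX.le_arithMean 𝔐 σ hσ hω1 hω h𝔐 hA
  have hXi := hX.inverse_le 𝔐 σ hσ hω1 hω h𝔐 hA
  have hYB := hY.le_arithMean 𝔐' σ hσ hω1 hω h𝔐' hB
  have hYi := hY.inverse_le 𝔐' σ hσ hω1 hω h𝔐' hB
  have hXp := hX.1
  have hlt : 1 / M < 1 / m := one_div_lt_one_div_of_lt hm hmM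
  have hM0 : 0 < 1 / M := by positivity
  -- The chord is taken in the variable `1/x` on `[1/M, 1/m]`, whose endpoint ratio is again `h`.
  have hratio : 1 / m / (1 / M) = M / m := by field_simp
  have hXM : X ≤ M • (1 : H →L[ℂ] H) := by
    refine hXA.trans ?_
    calc ∑ j, ω j • A j ≤ ∑ j, ω j • (M • (1 : H →L[ℂ] H)) :=
          Finset.sum_le_sum fun j _ => smul_le_smul_of_nonneg_left (hAM j) (hω j)
      _ = M • 1 := by rw [← Finset.sum_smul, hω1, one_smul]
  have hmX : m • (1 : H →L[ℂ] H) ≤ X := by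
    refine smul_one_le_of_inverse_le hXp hm (hXi.trans ?_)
    calc ∑ j, ω j • Ring.inverse (A j) ≤ ∑ j, ω j • (m⁻¹ • (1 : H →L[ℂ] H)) :=
          Finset.sum_le_sum fun j _ =>
            smul_le_smul_of_nonneg_left (inverse_le_inv_smul_one hm (hmA j)) (hω j)
      _ = m⁻¹ • 1 := by rw [← Finset.sum_smul, hω1, one_smul]
  have hup := hYB.trans (sum_map_rpow_le hω hω1 hm hmM hmA hAM Φ hr0 hXi)
  have hpow {x : ℝ} (hx : 0 < x) : (x⁻¹) ^ (-r) = x ^ r := by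
    rw [Real.rpow_neg (inv_pos.2 hx).le, Real.inv_rpow hx.le, inv_inv]
  refine ⟨?_, ?_, ?_⟩
  · rw [sub_le_iff_le_add]
    refine hup.trans ?_
    have h1 := affine_inverse_le_smul_rpow_add hXp (r := r) (κ := 1)
      (γ := gammaConst (1 / M) (1 / m) (-r) 1) (β := chordIntercept (1 / M) (1 / m) (-r))
      (α := chordSlope (1 / M) (1 / m) (-r)) fun x hx => by
        have hx0 := hXp.spectrum_real_pos x hx
        have := chord_le_rpow_add_gammaConst (neg_neg_of_pos hr0) hM0 hlt (inv_pos.2 hx0)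
        rw [hpow hx0] at this
        linarith
    have h2 := positiveMap_mono Φ h1
    rwa [one_smul, map_add Φ (gammaConst _ _ _ _ • 1), positiveMap_real_smul, hΦ] at h2
  -- The Kantorovich inequality is used on `[m ^ r, M ^ r]`; its constant dominates `4 M m / (M +
  -- m)²`.
  · have h1 := smul_sum_le_of_inverse_le hω hω1 hmr hmMr hmB hBM hY.1 hYi
    have h2 := smul_rpow_le_sum_rpow hω hω1 hm hmM hmA hAM hr0 hr1 hXA hmX hXM
    have h3 := positiveMap_mono Φ h2
    rw [positiveMap_real_smul, map_sum] at h3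
    simp only [positiveMap_real_smul] at h3
    have h4 : 0 ≤ (kantorovichConst (M / m) (-r))⁻¹ • Φ (X ^ r) := by
      refine smul_nonneg (inv_pos.2 (kantorovichConst_pos (neg_neg_of_pos hr0) hm hmM)).le ?_
      have := positiveMap_mono Φ (CFC.rpow_nonneg (a := X) (y := r))
      rwa [map_zero] at this
    rw [← smul_smul]
    refine le_trans ?_ h1
    exact (smul_le_smul_of_nonneg_right (kantorovich_ratio_le_rpow hr1.le hr0.le hm hmM) h4).trans
      (smul_le_smul_of_nonneg_left h3 (by positivity))
  · refine hup.trans ?_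
    have h1 := affine_inverse_le_smul_rpow_add hXp (r := r) (γ := 0)
      (κ := kantorovichConst (M / m) (-r)) (β := chordIntercept (1 / M) (1 / m) (-r))
      (α := chordSlope (1 / M) (1 / m) (-r)) fun x hx => by
        have hx0 := hXp.spectrum_real_pos x hx
        have := chord_le_kantorovichConst_mul (neg_neg_of_pos hr0) hM0 hlt (inv_pos.2 hx0)
        rw [hpow hx0, hratio] at this
        rwa [zero_add]
    have h2 := positiveMap_mono Φ h1
    rwa [zero_smul, zero_add, positiveMap_real_smul Φ (kantorovichConst _ _)] at h2
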